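/- **Setting.** Let $n\ge 2$, $p\ge 0$, let $\|\cdot\|$ be the Euclidean norm on $\mathbb{R}^p$, and let $\mathbb{G}_k=([n],\mathcal{E}_k)$, $k\ge 0$, be strongly connected directed graphs. For a strongly connected directed graph $\mathbb{G}$, let $\mathsf{D}(\mathbb{G})$ be its diameter (the largest length of a shortest directed path between an ordered pair of distinct nodes). A shortest-path covering $\mathcal{P}$ of $\mathbb{G}$ consists of one shortest directed path for every ordered pair of distinct nodes, and the maximal edge-utility $\mathsf{K}(\mathbb{G})$ is the maximum, over all shortest-path coverings $\mathcal{P}$ and all edges $e$ of $\mathbb{G}$, of the number of paths in $\mathcal{P}$ that pass through $e$. Let $A_k\in\mathbb{R}^{n\times n}$ be row-stochastic and $B_k\in\mathbb{R}^{n\times n}$ column-stochastic, both compatible with $\mathbb{G}_k$: for $M\in\{A_k,B_k\}$, $M_{ij}>0$ if $j=i$ or $(j,i)\in\mathcal{E}_k$, and $M_{ij}=0$ otherwise. Assume that there are $a,b>0$ such that, for all $k$, every positive entry of $A_k$ is at least $a$ and every positive entry of $B_k$ is at least $b$. Let $f_1,\dots,f_n:\mathbb{R}^p\to\mathbb{R}$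 be continuously differentiable with $\|\nabla f_i(x)-\nabla f_i(u)\|\le L\|x-u\|$ for all $x,u$, where $L>0$, and let $f=\frac1n\sum_{i=1}^n f_i$ satisfy $\langle\nabla f(x)-\nabla f(u),x-u\rangle\ge\mu\|x-u\|^2$ for all $x,u$, where $\mu>0$. For a stepsize $\alpha>0$ and arbitrary $x_i^0\in\mathbb{R}^p$, the AB/Push-Pull method is defined by $y_i^0=\nabla f_i(x_i^0)$ and, for $k\ge0$ and $i\in[n]$, $$x_i^{k+1}=\sum_{j=1}^n[A_k]_{ij}x_j^k-\alpha y_i^k,\qquad y_i^{k+1}=\sum_{j=1}^n[B_k]_{ij}y_j^k+\nabla f_i(x_i^{k+1})-\nabla f_i(x_i^k).$$ Let $\{\phi_k\}_{k\ge0}$ be a sequence of stochastic vectors with $\phi_{k+1}^{\top}A_k=\phi_k^{\top}$ for all $k\ge0$ (one always exists), and let $\pi_0=\frac1n\mathbf{1}$, $\pi_{k+1}=B_k\pi_k$. With $\min(v)$, $\max(v)$ the smallest and the largest entry of a vector $v$, put $$c_k=\sqrt{1-\frac{\min(\phi_{k+1})\,a^2}{\max^2(\phi_k)\,\mathsf{D}(\mathbb{G}_k)\mathsf{K}(\mathbb{G}_k)}},\qquad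 \tau_k=\sqrt{1-\frac{\min^2(\pi_k)\,b^2}{\max^2(\pi_k)\max(\pi_{k+1})\,\mathsf{D}(\mathbb{G}_k)\mathsf{K}(\mathbb{G}_k)}},$$ $$r_k=\sqrt n+\frac1{\sqrt{\min(\pi_{k+1})}},\qquad \varphi_k=\sqrt{\frac1{\min(\phi_k)}}.$$ Let $c,\tau\in(0,1)$, $r,\varphi\in\mathbb{R}$ and $\sigma>0$ satisfy $c_k\le c$, $\tau_k\le\tau$, $r_k\le r$, $\varphi_k\le\varphi$ and $\sigma\le\min(\pi_k)$ for all $k\ge0$, and put $$\eta=L\,(n\sigma\mu+L\sqrt n\,\varphi)\big((1+c)r\varphi+(1-c)r+(1-\tau)\sqrt n\,\varphi\big).$$ **Proposition.** If $$0<\alpha\le\min\left\{\frac{1-c}{L\sqrt n\,\varphi},\ \frac{1-\tau}{Lr},\ \frac{n\sigma\mu(1-\tau)(1-c)}{\eta},\ \frac{2}{n(L+\mu)}\right\},$$ then $f$ has a unique minimizer $x^*$ and $$\lim_{k\to\infty}\|x_i^k-x^*\|=0\qquad\text{for all }i\in[n],$$ with a linear rate: there are $C\in\mathbb{R}$ and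 $\rho\in[0,1)$ such that $\|x_i^k-x^*\|\le C\rho^k$ for all $i\in[n]$ and $k\ge0$. If moreover $\alpha<n\sigma\mu(1-\tau)(1-c)/\eta$, then the spectral radius $\rho_{M(\alpha)}$ of $$M(\alpha)=\begin{bmatrix}1-\alpha n\sigma\mu&\alpha L\sqrt n\,\varphi&\alpha\\ \alpha L\sqrt n\,\varphi&c+\alpha L\sqrt n\,\varphi&\alpha\\ \alpha L^2r\sqrt n\,\varphi&Lr(1+c)\varphi+\alpha L^2r\sqrt n\,\varphi&\tau+\alpha Lr\end{bmatrix}$$ is less than $1$, and there is $C\in\mathbb{R}$ such that $\|x_i^k-x^*\|\le C\,\rho_{M(\alpha)}^k$ for all $i\in[n]$ and $k\ge0$. -/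

import Mathlib

open Filter Topology
open scoped Gradient

namespace PushPull

/-! ### Directed graphs: paths, diameter, maximal edge-utility -/

section Graphs

/-- Directed paths from one vertex to another in a directed graph (vertices may repeat;
a path of minimal length never repeats a vertex). -/
inductive DiPath {V : Type*} (G : Digraph V) : V → V → Type _
  | nil (u : V) : DiPath G u u
  | cons {u v w : V} (h : G.Adj u v) (q : DiPath G v w) : DiPath G u w

/-- The list of edges of a directed path. -/
def DiPath.edges {V : Type*} {G : Digraph V} : {u v : V} → DiPath G u v → List (V × V)
  | _, _, DiPath.nil _ => []
  | _, _, @DiPath.cons _ _ u v _ _ q => (u, v) :: q.edges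

/-- The length of a directed path is its number of edges. -/
def DiPath.length {V : Type*} {G : Digraph V} {u v : V} (q : DiPath G u v) : ℕ :=
  q.edges.length

/-- There is a directed path from any node to any other node. -/
def StronglyConnected {V : Type*} (G : Digraph V) : Prop :=
  ∀ u v : V, Nonempty (DiPath G u v)

/-- A directed path is shortest if no path with the same end points has fewer edges. -/
def DiPath.IsShortest {V : Type*} {G : Digraph V} {u v : V} (q : DiPath G u v) : Prop :=
  ∀ q' : DiPath G u v, q.length ≤ q'.length

/-- The length of a shortest directed path from `u` to `v`. -/
noncomputable def diDist {V : Type*} (G : Digraph V) (u v : V) : ℕ :=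
  sInf (Set.range fun q : DiPath G u v => q.length)

/-- The diameter `D(G)`: the largest length of a shortest directed path between an ordered pair
of distinct nodes. -/
noncomputable def diameter {V : Type*} [Fintype V] [DecidableEq V] (G : Digraph V) : ℕ :=
  (Finset.univ : Finset V).offDiag.sup fun q => diDist G q.1 q.2

/-- A shortest-path graph covering: one shortest directed path for every ordered pair of
distinct nodes. (For `u = v` the only shortest path is the one without edges.) -/
structure Covering {V : Type*} (G : Digraph V) where
  path : (u v : V) → DiPath G u v
  shortest : ∀ u v, (path u v).IsShortest

/-- The utility of the edge `e`: the number of paths of the covering that pass through `e`. -/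
def Covering.utility {V : Type*} [Fintype V] [DecidableEq V] {G : Digraph V}
    (P : Covering G) (e : V × V) : ℕ :=
  ((Finset.univ : Finset V).offDiag.filter fun q => e ∈ (P.path q.1 q.2).edges).card

open scoped Classical in
/-- The maximum edge-utility `K(P)` of a covering `P`, over all edges of the graph. -/
noncomputable def Covering.maxUtility {V : Type*} [Fintype V] [DecidableEq V] {G : Digraph V}
    (P : Covering G) : ℕ :=
  ((Finset.univ : Finset (V × V)).filter fun e => G.Adj e.1 e.2).sup P.utility

/-- The maximal edge-utility `K(G)`, over all shortest-path coverings of the graph. -/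
noncomputable def maxEdgeUtility {V : Type*} [Fintype V] [DecidableEq V] (G : Digraph V) : ℕ :=
  ⨆ P : Covering G, P.maxUtility

/-- The supremum in `maxEdgeUtility` is over a bounded set, hence a maximum. -/
theorem bddAbove_maxUtility {V : Type*} [Fintype V] [DecidableEq V] (G : Digraph V) :
    BddAbove (Set.range fun P : Covering G => P.maxUtility) := by
  refine ⟨(Finset.univ : Finset V).offDiag.card, ?_⟩
  rintro _ ⟨P, rfl⟩
  exact Finset.sup_le fun e _ => Finset.card_filter_le _ _

end Graphs

/-! ### Mixing matrices and the associated stochastic vectors -/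

/-- Compatibility of a matrix with a directed graph: `M i j > 0` if `j` is an in-neighbour of `i`
or `j = i`, and `M i j = 0` otherwise. Equivalently (exchange the roles of the indices),
`M j i > 0` if `j` is an out-neighbour of `i` or `j = i`, and `M j i = 0` otherwise. -/
def Compatible {n : ℕ} (G : Digraph (Fin n)) (M : Matrix (Fin n) (Fin n) ℝ) : Prop :=
  ∀ i j, ((G.Adj j i ∨ j = i) → 0 < M i j) ∧ (¬ (G.Adj j i ∨ j = i) → M i j = 0)

/-- A sequence of stochastic vectors with `φ_{k+1}ᵀ A_k = φ_kᵀ` for all `k`. -/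
def IsAbsProb {n : ℕ} (A : ℕ → Matrix (Fin n) (Fin n) ℝ) (φ : ℕ → Fin n → ℝ) : Prop :=
  (∀ k, φ k ∈ stdSimplex ℝ (Fin n)) ∧ ∀ k, Matrix.vecMul (φ (k + 1)) (A k) = φ k

/-- Every sequence of row-stochastic matrices has such a sequence of stochastic vectors. -/
theorem exists_isAbsProb {n : ℕ} (hn : 0 < n) (A : ℕ → Matrix (Fin n) (Fin n) ℝ)
    (hA : ∀ k, A k ∈ Matrix.rowStochastic ℝ (Fin n)) : ∃ φ, IsAbsProb A φ := by
  have step : ∀ (M : Matrix (Fin n) (Fin n) ℝ), M ∈ Matrix.rowStochastic ℝ (Fin n) →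
      ∀ v ∈ stdSimplex ℝ (Fin n), Matrix.vecMul v M ∈ stdSimplex ℝ (Fin n) := by
    intro M hM v hv
    refine ⟨Matrix.nonneg_vecMul_of_mem_rowStochastic hM hv.1, ?_⟩
    simp only [Matrix.vecMul, dotProduct]
    rw [Finset.sum_comm]
    simp_rw [← Finset.mul_sum, Matrix.sum_row_of_mem_rowStochastic hM, mul_one]
    exact hv.2
  have fin : ∀ (N : ℕ) (A : ℕ → Matrix (Fin n) (Fin n) ℝ),
      (∀ k, A k ∈ Matrix.rowStochastic ℝ (Fin n)) →
      ∃ φ : ℕ → Fin n → ℝ, (∀ k, φ k ∈ stdSimplex ℝ (Fin n)) ∧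
        ∀ k < N, Matrix.vecMul (φ (k + 1)) (A k) = φ k := by
    intro N
    induction N with
    | zero =>
      intro A _
      exact ⟨fun _ => Pi.single ⟨0, hn⟩ 1, fun _ => single_mem_stdSimplex ℝ _, by simp⟩
    | succ N ih =>
      intro A hA
      obtain ⟨ψ, h1, h2⟩ := ih (fun k => A (k + 1)) (fun k => hA _)
      refine ⟨fun k => Nat.casesOn k (Matrix.vecMul (ψ 0) (A 0)) ψ, ?_, ?_⟩
      · rintro (_ | k)
        · exact step _ (hA 0) _ (h1 0)
        · exact h1 k
      · rintro (_ | k) hk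
        · rfl
        · exact h2 k (by omega)
  let K : Set (ℕ → Fin n → ℝ) := Set.pi Set.univ fun _ => stdSimplex ℝ (Fin n)
  have hK : IsCompact K := isCompact_univ_pi fun _ => isCompact_stdSimplex ℝ (Fin n)
  let t : ℕ → Set (ℕ → Fin n → ℝ) := fun N =>
    K ∩ {φ | ∀ k < N, Matrix.vecMul (φ (k + 1)) (A k) = φ k}
  have hcl : ∀ N, IsClosed (t N) := by
    intro N
    refine hK.isClosed.inter ?_
    simp only [Set.ofPred_forall]
    refine isClosed_iInter fun k => isClosed_iInter fun _ => isClosed_eq ?_ ?_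
    · exact (continuous_apply (k + 1)).matrix_vecMul continuous_const
    · exact continuous_apply k
  obtain ⟨φ, hφ⟩ := IsCompact.nonempty_iInter_of_sequence_nonempty_isCompact_isClosed t
    (fun N φ h => ⟨h.1, fun k hk => h.2 k (by omega)⟩)
    (fun N => by
      obtain ⟨φ, h1, h2⟩ := fin N A hA
      exact ⟨φ, fun k _ => h1 k, h2⟩)
    (hK.inter_right (by simp)) hcl
  rw [Set.mem_iInter] at hφ
  exact ⟨φ, fun k => (hφ 0).1 k trivial, fun k => (hφ (k + 1)).2 k (by omega)⟩

/-- The stochastic vectors `π_0 = (1/n) 1`, `π_{k+1} = B_k π_k`. -/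
noncomputable def piVec {n : ℕ} (B : ℕ → Matrix (Fin n) (Fin n) ℝ) : ℕ → Fin n → ℝ
  | 0 => fun _ => 1 / (n : ℝ)
  | k + 1 => Matrix.mulVec (B k) (piVec B k)

/-- The smallest entry of a vector. -/
noncomputable def minEntry {n : ℕ} (v : Fin n → ℝ) : ℝ := ⨅ i, v i

/-- The largest entry of a vector. -/
noncomputable def maxEntry {n : ℕ} (v : Fin n → ℝ) : ℝ := ⨆ i, v i

/-! ### The AB/Push-Pull method -/

/-- The iterates `(x^k, y^k)` of the AB/Push-Pull method with mixing matrices `A_k`, `B_k`, local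
objectives `f_i`, stepsize `α` and starting points `x_i^0`. -/
noncomputable def iterates {n p : ℕ} (A B : ℕ → Matrix (Fin n) (Fin n) ℝ)
    (f : Fin n → EuclideanSpace ℝ (Fin p) → ℝ) (α : ℝ) (x₀ : Fin n → EuclideanSpace ℝ (Fin p)) :
    ℕ → (Fin n → EuclideanSpace ℝ (Fin p)) × (Fin n → EuclideanSpace ℝ (Fin p))
  | 0 => (x₀, fun i => ∇ (f i) (x₀ i))
  | k + 1 =>
    let x := (iterates A B f α x₀ k).1
    let y := (iterates A B f α x₀ k).2
    let x' : Fin n → EuclideanSpace ℝ (Fin p) := fun i => (∑ j, A k i j • x j) - α • y i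
    (x', fun i => (∑ j, B k i j • y j) + ∇ (f i) (x' i) - ∇ (f i) (x i))

/-- The average objective `f = (1/n) ∑ f_i`. -/
noncomputable def avgObj {n p : ℕ} (f : Fin n → EuclideanSpace ℝ (Fin p) → ℝ) :
    EuclideanSpace ℝ (Fin p) → ℝ :=
  fun x => (1 / (n : ℝ)) * ∑ i, f i x

/-! ### The constants in the stepsize range -/

/-- `c_k = √(1 - min(φ_{k+1}) a² / (max(φ_k)² D(G_k) K(G_k)))`. -/
noncomputable def cSeq {n : ℕ} (G : ℕ → Digraph (Fin n)) (a : ℝ) (φ : ℕ → Fin n → ℝ)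
    (k : ℕ) : ℝ :=
  √(1 - minEntry (φ (k + 1)) * a ^ 2 /
    (maxEntry (φ k) ^ 2 * (diameter (G k) : ℝ) * (maxEdgeUtility (G k) : ℝ)))

/-- `τ_k = √(1 - min(π_k)² b² / (max(π_k)² max(π_{k+1}) D(G_k) K(G_k)))`. -/
noncomputable def tauSeq {n : ℕ} (G : ℕ → Digraph (Fin n)) (b : ℝ) (π : ℕ → Fin n → ℝ)
    (k : ℕ) : ℝ :=
  √(1 - minEntry (π k) ^ 2 * b ^ 2 /
    (maxEntry (π k) ^ 2 * maxEntry (π (k + 1)) *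
      (diameter (G k) : ℝ) * (maxEdgeUtility (G k) : ℝ)))

/-- `r_k = √n + 1 / √(min(π_{k+1}))`. -/
noncomputable def rSeq {n : ℕ} (π : ℕ → Fin n → ℝ) (k : ℕ) : ℝ :=
  √(n : ℝ) + 1 / √(minEntry (π (k + 1)))

/-- `ϕ_k = √(1 / min(φ_k))`. -/
noncomputable def phiSeq {n : ℕ} (φ : ℕ → Fin n → ℝ) (k : ℕ) : ℝ :=
  √(1 / minEntry (φ k))

/-- `η = L (nσμ + L√n ϕ) ((1+c) r ϕ + (1-c) r + (1-τ) √n ϕ)`. -/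
noncomputable def eta (n : ℕ) (L μ c τ r ϕ σ : ℝ) : ℝ :=
  L * (n * σ * μ + L * √(n : ℝ) * ϕ) *
    ((1 + c) * r * ϕ + (1 - c) * r + (1 - τ) * √(n : ℝ) * ϕ)

/-- The comparison matrix `M(α)`. -/
noncomputable def compMatrix (n : ℕ) (L μ c τ r ϕ σ α : ℝ) : Matrix (Fin 3) (Fin 3) ℝ :=
  !![1 - α * n * σ * μ, α * L * √(n : ℝ) * ϕ, α;
     α * L * √(n : ℝ) * ϕ, c + α * L * √(n : ℝ) * ϕ, α;
     α * L ^ 2 * r * √(n : ℝ) * ϕ,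
       L * r * (1 + c) * ϕ + α * L ^ 2 * r * √(n : ℝ) * ϕ, τ + α * L * r]

/-- The spectral radius of a real square matrix: the largest modulus of a complex eigenvalue. -/
noncomputable def specRad {m : ℕ} (M : Matrix (Fin m) (Fin m) ℝ) : ℝ :=
  (spectralRadius ℂ (M.map (algebraMap ℝ ℂ))).toReal

end PushPull

/-!
The proof follows three scalar errors along the iteration: the distance of the weighted mean
`x̂ = ∑ φ_k(i) x_i` to the minimizer, the consensus error of the `x_i` (weights `φ_k`), and the
tracking error of the scaled directions `y_i / π_k(i)` against `∑ y_j` (weights `π_k`). The vector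
`v_k` of these errors satisfies `v_{k+1} ≤ M(α) v_k` entrywise, one row each from
`norm_wmean_step_le`, `wnorm_consensus_step_le` and `wnorm_tracking_step_le`. Two facts feed them.

* A gradient step of an `L`-smooth, `μ`-strongly convex function with step `h ≤ 2 / (L + μ)`
  contracts by `1 - h μ` (`norm_gradient_step_sub_le`, by co-coercivity).
* Mixing over a strongly connected graph contracts a weighted dispersion
  (`wnorm_mix_sub_wmean_le`): mixing loses at least the squared differences along the edges, and
  these control all pairs of nodes through a shortest-path covering (`sum_norm_sub_sq_le`). Both
  matrices are covered, since `B_k` acts on `y_i / π_k(i)` as a row-stochastic matrix.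

All entries of `M(α)` are positive, so by Perron's theorem it has a positive eigenvector for its
spectral radius, and `v_k` decays at that rate (`exists_forall_le_mul_specRad_pow`). The stepsize
bound yields a positive vector `w` with `M(α) w < w`, so the spectral radius is less than one
(`specRad_compMatrix_lt_one`).

If `α` equals the third bound, `M(α)` has spectral radius one. The dispersion argument, however,
gains a factor two: it proves the contraction factor `c ^ 2` instead of `c` for the consensus
error, and with `c ^ 2` in place of `c` the third bound is strictly larger (`mul_eta_sq_lt`). The
linear rate for all admissible stepsizes is the spectral radius of that smaller matrix.
-/

namespace PushPull

/-! ### Gradient steps of smooth, strongly convex functions -/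

section ConvexAnalysis

variable {E : Type*} [NormedAddCommGroup E] [InnerProductSpace ℝ E] [CompleteSpace E]

/-- A lower bound `m ‖x - u‖²` on the increments of a gradient gives a quadratic lower bound on
the function. For `m > 0` this is strong convexity; for `m < 0`, applied to `-f`, it is the
descent lemma. -/
theorem add_inner_add_le_of_gradient {f : E → ℝ} {f' : E → E} {m : ℝ}
    (hf : ∀ x, HasGradientAt f (f' x) x)
    (hm : ∀ x u, m * ‖x - u‖ ^ 2 ≤ inner ℝ (f' x - f' u) (x - u)) (x y : E) :
    f x + inner ℝ (f' x) (y - x) + m / 2 * ‖y - x‖ ^ 2 ≤ f y := by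
  set d := y - x with hd
  let g : ℝ → ℝ := fun t => f (x + t • d) - t * inner ℝ (f' x) d - m / 2 * t ^ 2 * ‖d‖ ^ 2
  have hg : ∀ t, HasDerivAt g
      (inner ℝ (f' (x + t • d) - f' x) d - m * t * ‖d‖ ^ 2) t := by
    intro t
    have h1 : HasDerivAt (fun t : ℝ => x + t • d) d t := by
      simpa using ((hasDerivAt_id t).smul_const d).const_add x
    have h2 : HasDerivAt (fun t : ℝ => f (x + t • d)) (inner ℝ (f' (x + t • d)) d) t := by
      have := (hf (x + t • d)).hasFDerivAt.comp_hasDerivAt t h1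
      rwa [InnerProductSpace.toDual_apply_apply] at this
    have h3 := (h2.sub ((hasDerivAt_id t).mul_const (inner ℝ (f' x) d))).sub
      (((hasDerivAt_pow 2 t).const_mul (m / 2)).mul_const (‖d‖ ^ 2))
    refine h3.congr_deriv ?_
    rw [inner_sub_left]
    push_cast
    ring
  have hmono : MonotoneOn g (Set.Icc 0 1) := by
    refine monotoneOn_of_hasDerivWithinAt_nonneg (convex_Icc 0 1)
      (fun t _ => (hg t).continuousAt.continuousWithinAt)
      (fun t _ => (hg t).hasDerivWithinAt) ?_
    intro t ht
    rw [interior_Icc] at ht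
    have h := hm (x + t • d) x
    rw [add_sub_cancel_left, norm_smul, inner_smul_right, Real.norm_eq_abs, mul_pow, sq_abs] at h
    have : 0 ≤ t * (inner ℝ (f' (x + t • d) - f' x) d - m * t * ‖d‖ ^ 2) := by nlinarith
    exact nonneg_of_mul_nonneg_right this ht.1
  have h01 := hmono (Set.left_mem_Icc.2 zero_le_one) (Set.right_mem_Icc.2 zero_le_one) zero_le_one
  simp only [g, zero_smul, add_zero, one_smul, zero_mul, sub_zero, one_mul, one_pow, mul_one,
    mul_zero, ne_eq, OfNat.ofNat_ne_zero, not_false_eq_true, zero_pow] at h01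
  rw [hd, add_sub_cancel] at h01
  linarith

/-- Co-coercivity of the gradient of a convex function whose gradient increments are bounded above
by `ℓ ‖x - u‖²` (one half of the symmetric inequality): after subtracting the linear function
`⟨f' y, ·⟩`, the point `y` is a minimizer, and a gradient step from `x` decreases the value by
`‖f' x - f' y‖² / (2ℓ)`. -/
theorem norm_sq_gradient_sub_le {f : E → ℝ} {f' : E → E} {l : ℝ} (hl : 0 < l)
    (hf : ∀ x, HasGradientAt f (f' x) x)
    (h0 : ∀ x u, 0 ≤ inner ℝ (f' x - f' u) (x - u))
    (h1 : ∀ x u, inner ℝ (f' x - f' u) (x - u) ≤ l * ‖x - u‖ ^ 2) (x y : E) :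
    ‖f' x - f' y‖ ^ 2 ≤ 2 * l * (f x - f y - inner ℝ (f' y) (x - y)) := by
  have hneg : ∀ x, HasGradientAt (fun z => - f z) (- f' x) x := fun x => by
    rw [hasGradientAt_iff_hasFDerivAt, map_neg]
    exact (hf x).hasFDerivAt.neg
  set g := f' x - f' y with hg
  set z := x - l⁻¹ • g with hz
  have hlow := add_inner_add_le_of_gradient (m := 0) hf (fun x u => by simpa using h0 x u) y z
  have hup := add_inner_add_le_of_gradient (m := -l) hneg
    (fun x u => by
      have := h1 x u
      rw [← neg_sub', inner_neg_left]
      linarith) x z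
  have e1 : z - x = -(l⁻¹ • g) := by rw [hz]; abel
  have e2 : z - y = (x - y) - l⁻¹ • g := by rw [hz]; abel
  have e3 : inner ℝ (f' x) g - inner ℝ (f' y) g = ‖g‖ ^ 2 := by
    rw [← inner_sub_left, ← hg, real_inner_self_eq_norm_sq]
  rw [e1, norm_neg, norm_smul, inner_neg_neg, inner_smul_right, mul_pow, Real.norm_eq_abs,
    sq_abs] at hup
  rw [e2, inner_sub_right, inner_smul_right] at hlow
  have e4 : l⁻¹ * l = 1 := inv_mul_cancel₀ hl.ne'
  have key : l⁻¹ * ‖g‖ ^ 2 / 2 ≤ f x - f y - inner ℝ (f' y) (x - y) := by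
    have : -l / 2 * (l⁻¹ ^ 2 * ‖g‖ ^ 2) = - (l⁻¹ * ‖g‖ ^ 2 / 2) := by
      field_simp
    nlinarith
  calc ‖g‖ ^ 2 = 2 * l * (l⁻¹ * ‖g‖ ^ 2 / 2) := by field_simp
    _ ≤ _ := by gcongr

/-- Co-coercivity in symmetric form; the case `ℓ = 0` is obtained as a limit. -/
theorem norm_sq_gradient_sub_le_inner {f : E → ℝ} {f' : E → E} {l : ℝ} (hl : 0 ≤ l)
    (hf : ∀ x, HasGradientAt f (f' x) x)
    (h0 : ∀ x u, 0 ≤ inner ℝ (f' x - f' u) (x - u))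
    (h1 : ∀ x u, inner ℝ (f' x - f' u) (x - u) ≤ l * ‖x - u‖ ^ 2) (x y : E) :
    ‖f' x - f' y‖ ^ 2 ≤ l * inner ℝ (f' x - f' y) (x - y) := by
  have hpos : ∀ l' : ℝ, l < l' → ‖f' x - f' y‖ ^ 2 ≤ l' * inner ℝ (f' x - f' y) (x - y) := by
    intro l' hl'
    have h1' : ∀ x u, inner ℝ (f' x - f' u) (x - u) ≤ l' * ‖x - u‖ ^ 2 := fun x u =>
      (h1 x u).trans (by gcongr)
    have a1 := norm_sq_gradient_sub_le (hl.trans_lt hl') hf h0 h1' x y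
    have a2 := norm_sq_gradient_sub_le (hl.trans_lt hl') hf h0 h1' y x
    rw [norm_sub_rev] at a2
    have e : inner ℝ (f' x - f' y) (x - y)
        = (- inner ℝ (f' y) (x - y)) + (- inner ℝ (f' x) (y - x)) := by
      rw [← neg_sub x y, inner_neg_right, inner_sub_left]; ring
    rw [e]
    nlinarith
  have ht : Tendsto (fun l' : ℝ => l' * inner ℝ (f' x - f' y) (x - y)) (𝓝[>] l)
      (𝓝 (l * inner ℝ (f' x - f' y) (x - y))) :=
    ((continuous_id.mul continuous_const).tendsto l).mono_left nhdsWithin_le_nhds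
  exact ge_of_tendsto ht (eventually_nhdsWithin_of_forall hpos)

/-- A gradient step of size at most `2 / (L + μ)` contracts with factor `1 - h μ`: co-coercivity is
applied to `f - μ/2 ‖·‖²`, which is convex with `L - μ` in place of `L`. -/
theorem norm_gradient_step_sub_le {f : E → ℝ} {f' : E → E} {L μ h : ℝ} (hL : 0 < L) (hμ : 0 < μ)
    (hf : ∀ x, HasGradientAt f (f' x) x)
    (hLip : ∀ x u, ‖f' x - f' u‖ ≤ L * ‖x - u‖)
    (hmono : ∀ x u, μ * ‖x - u‖ ^ 2 ≤ inner ℝ (f' x - f' u) (x - u))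
    (hh : 0 ≤ h) (hh2 : h ≤ 2 / (L + μ)) (x y : E) :
    ‖(x - h • f' x) - (y - h • f' y)‖ ≤ (1 - h * μ) * ‖x - y‖ := by
  rcases eq_or_ne x y with rfl | hxy
  · simp
  have hup : ∀ x u, inner ℝ (f' x - f' u) (x - u) ≤ L * ‖x - u‖ ^ 2 := fun x u => by
    refine (real_inner_le_norm _ _).trans ?_
    have := mul_le_mul_of_nonneg_right (hLip x u) (norm_nonneg (x - u))
    nlinarith
  have hd : 0 < ‖x - y‖ ^ 2 := by
    have := norm_pos_iff.2 (sub_ne_zero.2 hxy)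
    positivity
  have hμL : μ ≤ L := le_of_mul_le_mul_right ((hmono x y).trans (hup x y)) hd
  have hg : ∀ x, HasGradientAt (fun z => f z - μ / 2 * ‖z‖ ^ 2) (f' x - μ • x) x := fun x => by
    rw [hasGradientAt_iff_hasFDerivAt]
    have h1 := (hf x).hasFDerivAt.sub (((hasFDerivAt_id x).norm_sq).const_mul (μ / 2))
    refine h1.congr_fderiv ?_
    ext v
    simp
    ring
  have einn : ∀ x u, inner ℝ ((f' x - μ • x) - (f' u - μ • u)) (x - u)
      = inner ℝ (f' x - f' u) (x - u) - μ * ‖x - u‖ ^ 2 := fun x u => by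
    rw [show (f' x - μ • x) - (f' u - μ • u) = (f' x - f' u) - μ • (x - u) by
      rw [smul_sub]; abel, inner_sub_left, inner_smul_left, real_inner_self_eq_norm_sq]
    simp
  have hco := norm_sq_gradient_sub_le_inner (l := L - μ) (sub_nonneg.2 hμL) hg
    (fun x u => by rw [einn]; linarith [hmono x u])
    (fun x u => by rw [einn]; linarith [hup x u]) x y
  set d := x - y with hdd
  set g := (f' x - μ • x) - (f' y - μ • y) with hgg
  have hin : 0 ≤ inner ℝ g d := by rw [hgg, hdd, einn]; linarith [hmono x y]
  have hstep : (x - h • f' x) - (y - h • f' y) = (1 - h * μ) • d - h • g := by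
    rw [hdd, hgg]; module
  rw [le_div_iff₀ (by positivity)] at hh2
  have hhμ : 0 ≤ 1 - h * μ := by nlinarith
  rw [hstep]
  refine le_of_sq_le_sq ?_ (mul_nonneg hhμ (norm_nonneg _))
  rw [norm_sub_sq_real, norm_smul, norm_smul, inner_smul_left, inner_smul_right,
    Real.norm_of_nonneg hhμ, Real.norm_of_nonneg hh, real_inner_comm g d]
  simp only [conj_trivial]
  have : h * (h * ‖g‖ ^ 2) ≤ h * (h * ((L - μ) * inner ℝ g d)) := by gcongr
  nlinarith [mul_nonneg (mul_nonneg hh hin) (by linarith : 0 ≤ 2 - h * (L + μ))]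

/-- The fixed point of a contracting gradient step is a critical point. -/
theorem exists_gradient_eq_zero {f : E → ℝ} {f' : E → E} {L μ : ℝ} (hL : 0 < L) (hμ : 0 < μ)
    (hf : ∀ x, HasGradientAt f (f' x) x)
    (hLip : ∀ x u, ‖f' x - f' u‖ ≤ L * ‖x - u‖)
    (hmono : ∀ x u, μ * ‖x - u‖ ^ 2 ≤ inner ℝ (f' x - f' u) (x - u)) :
    ∃ z, f' z = 0 := by
  set h := 1 / (L + μ) with hh
  have hpos : 0 < h := by positivity
  have hμ1 : h * μ < 1 := by
    rw [hh, one_div, inv_mul_lt_iff₀ (by positivity)]; linarith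
  have hc : ContractingWith (Real.toNNReal (1 - h * μ)) fun x => x - h • f' x := by
    refine ⟨?_, LipschitzWith.of_dist_le_mul fun x y => ?_⟩
    · rw [← NNReal.coe_lt_coe, Real.coe_toNNReal _ (by linarith), NNReal.coe_one]
      nlinarith
    · rw [Real.coe_toNNReal _ (by linarith), dist_eq_norm, dist_eq_norm]
      refine norm_gradient_step_sub_le hL hμ hf hLip hmono hpos.le ?_ x y
      rw [hh]; gcongr; norm_num
  refine ⟨hc.fixedPoint, ?_⟩
  have := hc.fixedPoint_isFixedPt
  rw [Function.IsFixedPt, sub_eq_self, smul_eq_zero] at this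
  exact this.resolve_left hpos.ne'

/-- A critical point of a strongly convex function is its unique minimizer. -/
theorem unique_minimizer_of_gradient_eq_zero {f : E → ℝ} {f' : E → E} {μ : ℝ} (hμ : 0 < μ)
    (hf : ∀ x, HasGradientAt f (f' x) x)
    (hmono : ∀ x u, μ * ‖x - u‖ ^ 2 ≤ inner ℝ (f' x - f' u) (x - u)) {x : E} (hx : f' x = 0) :
    (∀ z, f x ≤ f z) ∧ ∀ z, (∀ w, f z ≤ f w) → z = x := by
  have key : ∀ z, f x + μ / 2 * ‖z - x‖ ^ 2 ≤ f z := fun z => by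
    simpa [hx] using add_inner_add_le_of_gradient hf hmono x z
  refine ⟨fun z => le_trans (by simp; positivity) (key z), fun z hz => ?_⟩
  have h1 := (key z).trans (hz x)
  have h2 : ‖z - x‖ ^ 2 ≤ 0 := by nlinarith
  have h3 : ‖z - x‖ = 0 := (pow_eq_zero_iff two_ne_zero).1 (le_antisymm h2 (by positivity))
  exact sub_eq_zero.1 (norm_eq_zero.1 h3)

end ConvexAnalysis

/-! ### Shortest-path coverings -/

section Paths

variable {V : Type*} {G : Digraph V}

theorem DiPath.adj_of_mem_edges {u v : V} (q : DiPath G u v) {e : V × V} (he : e ∈ q.edges) :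
    G.Adj e.1 e.2 := by
  induction q with
  | nil u => simp [DiPath.edges] at he
  | cons h q ih =>
    rw [DiPath.edges, List.mem_cons] at he
    rcases he with rfl | he
    · exact h
    · exact ih he

/-- Following a path from the tail of one of its edges on. -/
theorem DiPath.exists_length_le_of_mem_edges {u v : V} (q : DiPath G u v) {e : V × V}
    (he : e ∈ q.edges) : ∃ q' : DiPath G e.1 v, q'.length ≤ q.length := by
  induction q with
  | nil u => simp [DiPath.edges] at he
  | cons h q ih =>
    rw [DiPath.edges, List.mem_cons] at he
    rcases he with rfl | he
    · exact ⟨DiPath.cons h q, le_rfl⟩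
    · obtain ⟨q', hq'⟩ := ih he
      exact ⟨q', hq'.trans (by simp [DiPath.length, DiPath.edges])⟩

theorem DiPath.IsShortest.nodup_edges {u v : V} {q : DiPath G u v} (hq : q.IsShortest) :
    q.edges.Nodup := by
  induction q with
  | nil u => simp [DiPath.edges]
  | cons h q ih =>
    rw [DiPath.edges, List.nodup_cons]
    constructor
    · intro hmem
      obtain ⟨q', hq'⟩ := q.exists_length_le_of_mem_edges hmem
      have := hq q'
      simp only [DiPath.length, DiPath.edges, List.length_cons] at this hq'
      omega
    · refine ih fun q' => ?_
      have := hq (DiPath.cons h q')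
      simpa [DiPath.length, DiPath.edges] using this

theorem exists_isShortest (hG : StronglyConnected G) (u v : V) :
    ∃ q : DiPath G u v, q.IsShortest ∧ q.length = diDist G u v := by
  obtain ⟨q₀⟩ := hG u v
  have hne : (Set.range fun q : DiPath G u v => q.length).Nonempty := ⟨_, q₀, rfl⟩
  obtain ⟨q, hq⟩ := Nat.sInf_mem hne
  refine ⟨q, fun q' => ?_, hq⟩
  have : q.length = sInf (Set.range fun q : DiPath G u v => q.length) := hq
  rw [this]
  exact Nat.sInf_le ⟨q', rfl⟩

variable {E : Type*} [NormedAddCommGroup E]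

theorem DiPath.norm_sub_le_sum {u v : V} (q : DiPath G u v) (x : V → E) :
    ‖x u - x v‖ ≤ (q.edges.map fun e => ‖x e.1 - x e.2‖).sum := by
  induction q with
  | nil u => simp [DiPath.edges]
  | @cons u v w h q ih =>
    rw [DiPath.edges, List.map_cons, List.sum_cons]
    calc ‖x u - x w‖ = ‖(x u - x v) + (x v - x w)‖ := by rw [sub_add_sub_cancel]
      _ ≤ _ := (norm_add_le _ _).trans (by gcongr)

theorem DiPath.IsShortest.norm_sub_sq_le [DecidableEq V] {u v : V} {q : DiPath G u v}
    (hq : q.IsShortest) (x : V → E) :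
    ‖x u - x v‖ ^ 2 ≤ q.length * ∑ e ∈ q.edges.toFinset, ‖x e.1 - x e.2‖ ^ 2 := by
  have h1 := q.norm_sub_le_sum x
  rw [← List.sum_toFinset _ hq.nodup_edges] at h1
  calc ‖x u - x v‖ ^ 2 ≤ (∑ e ∈ q.edges.toFinset, ‖x e.1 - x e.2‖) ^ 2 := by gcongr
    _ ≤ q.edges.toFinset.card * ∑ e ∈ q.edges.toFinset, ‖x e.1 - x e.2‖ ^ 2 :=
      sq_sum_le_card_mul_sum_sq
    _ = _ := by rw [List.toFinset_card_of_nodup hq.nodup_edges]; rfl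

variable [Fintype V] [DecidableEq V]

open scoped Classical in
/-- The shortest paths of a covering connect all ordered pairs of nodes, each with at most `D(G)`
edges, and each edge serves at most `K(G)` of them. -/
theorem sum_norm_sub_sq_le (hG : StronglyConnected G) (x : V → E) :
    ∑ u, ∑ v, ‖x u - x v‖ ^ 2 ≤ (diameter G : ℝ) * maxEdgeUtility G *
      ∑ e : V × V with G.Adj e.1 e.2, ‖x e.1 - x e.2‖ ^ 2 := by
  choose path hpath hdist using fun u v => exists_isShortest hG u v
  let P : Covering G := ⟨path, hpath⟩
  have hK : P.maxUtility ≤ maxEdgeUtility G := le_ciSup (bddAbove_maxUtility G) P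
  set S := (Finset.univ : Finset (V × V)).filter fun e => G.Adj e.1 e.2 with hS
  have hpair : ∀ q ∈ (Finset.univ : Finset V).offDiag, ‖x q.1 - x q.2‖ ^ 2 ≤
      (diameter G : ℝ) * ∑ e ∈ S, if e ∈ (path q.1 q.2).edges then ‖x e.1 - x e.2‖ ^ 2 else 0 := by
    intro q hq
    refine ((hpath q.1 q.2).norm_sub_sq_le x).trans ?_
    rw [← Finset.sum_filter]
    have e1 : (path q.1 q.2).edges.toFinset = S.filter fun e => e ∈ (path q.1 q.2).edges := by
      ext e
      simp only [List.mem_toFinset, hS, Finset.mem_filter, Finset.mem_univ, true_and]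
      exact ⟨fun h => ⟨DiPath.adj_of_mem_edges _ h, h⟩, fun h => h.2⟩
    rw [e1]
    gcongr
    rw [hdist]
    exact Finset.le_sup (f := fun q : V × V => diDist G q.1 q.2) hq
  calc ∑ u, ∑ v, ‖x u - x v‖ ^ 2
      = ∑ q ∈ (Finset.univ : Finset V).offDiag, ‖x q.1 - x q.2‖ ^ 2 := by
        rw [← Fintype.sum_prod_type']
        symm
        refine Finset.sum_subset (Finset.subset_univ _) fun q _ hq => ?_
        have : q.1 = q.2 := by simpa using hq
        simp [this]
    _ ≤ ∑ q ∈ (Finset.univ : Finset V).offDiag, (diameter G : ℝ) *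
          ∑ e ∈ S, if e ∈ (path q.1 q.2).edges then ‖x e.1 - x e.2‖ ^ 2 else 0 :=
        Finset.sum_le_sum hpair
    _ = (diameter G : ℝ) * ∑ e ∈ S, (P.utility e : ℝ) * ‖x e.1 - x e.2‖ ^ 2 := by
        rw [← Finset.mul_sum, Finset.sum_comm]
        congr 1
        refine Finset.sum_congr rfl fun e _ => ?_
        rw [← Finset.sum_filter, Finset.sum_const, nsmul_eq_mul]
        rfl
    _ ≤ (diameter G : ℝ) * ∑ e ∈ S, (maxEdgeUtility G : ℝ) * ‖x e.1 - x e.2‖ ^ 2 := by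
        gcongr with e he
        exact (Finset.le_sup (f := P.utility) he).trans hK
    _ = _ := by rw [← Finset.mul_sum, mul_assoc]

end Paths

/-! ### Positive matrices -/

section Perron

open Matrix

variable {ι : Type*} [Fintype ι]

/-- The easy half of the Collatz–Wielandt formula: a positive vector `w` with `M w ≤ l w` bounds
the modulus of every complex eigenvalue by `l`. -/
theorem norm_le_of_mem_spectrum [DecidableEq ι] {M : Matrix ι ι ℝ} (hM : ∀ i j, 0 ≤ M i j)
    {w : ι → ℝ} (hw : ∀ i, 0 < w i) {l : ℝ} (hl : ∀ i, (M *ᵥ w) i ≤ l * w i)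
    {z : ℂ} (hz : z ∈ spectrum ℂ (M.map (algebraMap ℝ ℂ))) : ‖z‖ ≤ l := by
  rw [← Matrix.spectrum_toLin', ← Module.End.hasEigenvalue_iff_mem_spectrum] at hz
  obtain ⟨v, hv⟩ := hz.exists_hasEigenvector
  have hv1 := hv.apply_eq_smul
  have hv2 := hv.2
  rw [Matrix.toLin'_apply] at hv1
  obtain ⟨i₀, hi₀⟩ := Function.ne_iff.1 hv2
  have : Nonempty ι := ⟨i₀⟩
  -- an index at which `‖v i‖ / w i` is largest
  obtain ⟨i, hi⟩ := Finite.exists_max fun i => ‖v i‖ / w i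
  set s := ‖v i‖ / w i with hs
  have hs0 : 0 < s := lt_of_lt_of_le (div_pos (norm_pos_iff.2 hi₀) (hw i₀)) (hi i₀)
  have hvs : ∀ j, ‖v j‖ ≤ s * w j := fun j => (div_le_iff₀ (hw j)).1 (hi j)
  have hvi : ‖v i‖ = s * w i := by rw [hs, div_mul_cancel₀ _ (hw i).ne']
  have h1 : ‖z‖ * (s * w i) ≤ l * (s * w i) := by
    calc ‖z‖ * (s * w i) = ‖(z • v) i‖ := by rw [← hvi, Pi.smul_apply, norm_smul]
      _ = ‖∑ j, (M i j : ℂ) * v j‖ := by rw [← hv1]; rfl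
      _ ≤ ∑ j, M i j * ‖v j‖ := by
        refine (norm_sum_le _ _).trans (Finset.sum_le_sum fun j _ => ?_)
        rw [norm_mul, Complex.norm_real, Real.norm_of_nonneg (hM i j)]
      _ ≤ ∑ j, M i j * (s * w j) :=
        Finset.sum_le_sum fun j _ => mul_le_mul_of_nonneg_left (hvs j) (hM i j)
      _ = s * (M *ᵥ w) i := by
        simp only [Matrix.mulVec, dotProduct, Finset.mul_sum]
        exact Finset.sum_congr rfl fun j _ => by ring
      _ ≤ s * (l * w i) := by gcongr; exact hl i
      _ = _ := by ring
  exact le_of_mul_le_mul_right h1 (mul_pos hs0 (hw i))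

/-- The existence part of Perron's theorem: a positive matrix has a positive eigenvector. -/
theorem exists_pos_eigenvector [Nonempty ι] {M : Matrix ι ι ℝ} (hM : ∀ i j, 0 < M i j) :
    ∃ (l : ℝ) (w : ι → ℝ), 0 ≤ l ∧ (∀ i, 0 < w i) ∧ M *ᵥ w = l • w := by
  classical
  -- a pair `(l, w)` with `w` in the simplex and `l w ≤ M w` for which `l` is largest
  set R := ∑ i, ∑ j, M i j with hR
  have hpos : ∀ v : ι → ℝ, (∀ i, 0 ≤ v i) → v ≠ 0 → ∀ i, 0 < (M *ᵥ v) i := by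
    intro v hv hv0 i
    obtain ⟨j, hj⟩ := Function.ne_iff.1 hv0
    exact Finset.sum_pos' (fun j _ => mul_nonneg (hM i j).le (hv j))
      ⟨j, Finset.mem_univ _, mul_pos (hM i j) (lt_of_le_of_ne (hv j) (Ne.symm hj))⟩
  have hbound : ∀ (l : ℝ) (v : ι → ℝ), v ∈ stdSimplex ℝ ι → (∀ i, l * v i ≤ (M *ᵥ v) i) →
      l ≤ R := by
    intro l v hv h
    calc l = ∑ i, l * v i := by rw [← Finset.mul_sum, hv.2, mul_one]
      _ ≤ ∑ i, (M *ᵥ v) i := Finset.sum_le_sum fun i _ => h i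
      _ ≤ R := by
        refine Finset.sum_le_sum fun i _ => Finset.sum_le_sum fun j _ => ?_
        have : v j ≤ 1 := by
          rw [← hv.2]; exact Finset.single_le_sum (fun i _ => hv.1 i) (Finset.mem_univ j)
        exact mul_le_of_le_one_right (hM i j).le this
  let K : Set (ℝ × (ι → ℝ)) := (Set.Icc 0 R ×ˢ stdSimplex ℝ ι) ∩
    {q | ∀ i, q.1 * q.2 i ≤ (M *ᵥ q.2) i}
  have hK : IsCompact K := by
    refine (isCompact_Icc.prod (isCompact_stdSimplex ℝ ι)).inter_right ?_
    simp only [Set.ofPred_forall]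
    refine isClosed_iInter fun i => isClosed_le ?_ ?_
    · fun_prop
    · have : Continuous fun q : ℝ × (ι → ℝ) => M *ᵥ q.2 :=
        Continuous.matrix_mulVec continuous_const continuous_snd
      exact (continuous_apply i).comp this
  have i₀ : ι := Classical.arbitrary ι
  have hKne : K.Nonempty := by
    refine ⟨(0, Pi.single i₀ 1), ⟨⟨le_rfl, ?_⟩, single_mem_stdSimplex ℝ _⟩, fun i => ?_⟩
    · exact Finset.sum_nonneg fun i _ => Finset.sum_nonneg fun j _ => (hM i j).le
    · simpa using (hM i i₀).le
  obtain ⟨⟨l, w⟩, ⟨⟨⟨hl0, -⟩, hw⟩, hlw⟩, hmax⟩ := hK.exists_isMaxOn hKne continuous_fst.continuousOn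
  simp only at hl0 hw hlw
  have hw0 : w ≠ 0 := by
    rintro rfl
    simpa using hw.2
  have hMw := hpos w hw.1 hw0
  have heq : M *ᵥ w = l • w := by
    by_contra hne
    -- then `M w` satisfies the inequality strictly, so `l` could be increased
    have hd0 : M *ᵥ w - l • w ≠ 0 := sub_ne_zero.2 hne
    have hstrict := hpos _ (fun i => by simpa using hlw i) hd0
    rw [Matrix.mulVec_sub, Matrix.mulVec_smul] at hstrict
    set y := M *ᵥ w with hy
    have hy0 : y ≠ 0 := fun h => by simpa [h] using hMw i₀
    obtain ⟨i₁, hi₁⟩ := Finite.exists_min fun i => (M *ᵥ y) i / y i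
    set l' := (M *ᵥ y) i₁ / y i₁ with hl'
    have hll' : l < l' := by
      rw [hl', lt_div_iff₀ (hMw i₁)]
      simpa using hstrict i₁
    set t := ∑ i, y i with ht
    have ht0 : 0 < t := Finset.sum_pos (fun i _ => hMw i) Finset.univ_nonempty
    have hmem : t⁻¹ • y ∈ stdSimplex ℝ ι := by
      refine ⟨fun i => mul_nonneg (inv_nonneg.2 ht0.le) (hMw i).le, ?_⟩
      simp only [Pi.smul_apply, smul_eq_mul, ← Finset.mul_sum]
      exact inv_mul_cancel₀ ht0.ne'
    have hle : ∀ i, l' * (t⁻¹ • y) i ≤ (M *ᵥ (t⁻¹ • y)) i := by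
      intro i
      have h := (le_div_iff₀ (hMw i)).1 (hi₁ i)
      rw [Matrix.mulVec_smul, Pi.smul_apply, Pi.smul_apply, smul_eq_mul, smul_eq_mul,
        mul_left_comm]
      exact mul_le_mul_of_nonneg_left h (inv_nonneg.2 ht0.le)
    have hK' : (l', t⁻¹ • y) ∈ K :=
      ⟨⟨⟨hl0.trans hll'.le, hbound _ _ hmem hle⟩, hmem⟩, hle⟩
    exact absurd (hmax hK') (not_le.2 hll')
  refine ⟨l, w, hl0, fun i => ?_, heq⟩
  have h := hMw i
  rw [heq, Pi.smul_apply, smul_eq_mul] at h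
  exact pos_of_mul_pos_right h hl0

theorem spectralRadius_le_of_mulVec_le [DecidableEq ι] {M : Matrix ι ι ℝ} (hM : ∀ i j, 0 ≤ M i j)
    {w : ι → ℝ} (hw : ∀ i, 0 < w i) {l : ℝ} (hl0 : 0 ≤ l) (hl : ∀ i, (M *ᵥ w) i ≤ l * w i) :
    spectralRadius ℂ (M.map (algebraMap ℝ ℂ)) ≤ ENNReal.ofReal l := by
  refine iSup₂_le fun z hz => ?_
  rw [ENNReal.le_ofReal_iff_toReal_le ENNReal.coe_ne_top hl0]
  exact norm_le_of_mem_spectrum hM hw hl hz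

theorem specRad_lt_one {m : ℕ} {M : Matrix (Fin m) (Fin m) ℝ} (hM : ∀ i j, 0 ≤ M i j)
    {w : Fin m → ℝ} (hw : ∀ i, 0 < w i) (hl : ∀ i, (M *ᵥ w) i < w i) : specRad M < 1 := by
  -- the largest of `0` and of the quotients `(M w)_i / w_i`
  obtain ⟨l, hl0, hl1, hlw⟩ : ∃ l : ℝ, 0 ≤ l ∧ l < 1 ∧ ∀ i, (M *ᵥ w) i ≤ l * w i := by
    rcases isEmpty_or_nonempty (Fin m) with h | h
    · exact ⟨0, le_rfl, zero_lt_one, fun i => h.elim i⟩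
    · obtain ⟨i, hi⟩ := Finite.exists_max fun i => (M *ᵥ w) i / w i
      have h0 : 0 ≤ (M *ᵥ w) i := by
        rw [Matrix.mulVec, dotProduct]
        exact Finset.sum_nonneg fun j _ => mul_nonneg (hM i j) (hw j).le
      exact ⟨(M *ᵥ w) i / w i, div_nonneg h0 (hw i).le, (div_lt_one (hw i)).2 (hl i),
        fun j => (div_le_iff₀ (hw j)).1 (hi j)⟩
  have h := ENNReal.toReal_mono ENNReal.ofReal_ne_top
    (spectralRadius_le_of_mulVec_le hM hw hl0 hlw)
  rw [ENNReal.toReal_ofReal hl0] at h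
  exact h.trans_lt hl1

/-- Perron's theorem: the spectral radius of a positive matrix is an eigenvalue with a positive
eigenvector. -/
theorem exists_pos_mulVec_eq_specRad_smul {m : ℕ} [NeZero m] {M : Matrix (Fin m) (Fin m) ℝ}
    (hM : ∀ i j, 0 < M i j) : ∃ w : Fin m → ℝ, (∀ i, 0 < w i) ∧ M *ᵥ w = specRad M • w := by
  obtain ⟨l, w, hl0, hw, h⟩ := exists_pos_eigenvector hM
  have hle := spectralRadius_le_of_mulVec_le (fun i j => (hM i j).le) hw hl0
    (fun i => by rw [h]; rfl)
  have hmem : (l : ℂ) ∈ spectrum ℂ (M.map (algebraMap ℝ ℂ)) := by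
    rw [← Matrix.spectrum_toLin', ← Module.End.hasEigenvalue_iff_mem_spectrum]
    refine Module.End.hasEigenvalue_of_hasEigenvector (x := fun i => (w i : ℂ)) ⟨?_, ?_⟩
    · rw [Module.End.mem_eigenspace_iff, Matrix.toLin'_apply]
      ext i
      have hi := congrFun h i
      simp only [Matrix.mulVec, dotProduct, Matrix.map_apply, Pi.smul_apply, smul_eq_mul,
        Complex.coe_algebraMap] at hi ⊢
      exact_mod_cast hi
    · intro h0
      have := congrFun h0 0
      simp only [Pi.zero_apply, Complex.ofReal_eq_zero] at this
      exact (hw 0).ne' this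
  have hge : ENNReal.ofReal l ≤ spectralRadius ℂ (M.map (algebraMap ℝ ℂ)) := by
    refine le_trans (le_of_eq ?_) (le_iSup₂ (f := fun z _ => (‖z‖₊ : ENNReal)) (l : ℂ) hmem)
    rw [show (‖(l : ℂ)‖₊ : ENNReal) = ‖(l : ℂ)‖ₑ from rfl, ← ofReal_norm,
      Complex.norm_real, Real.norm_of_nonneg hl0]
  refine ⟨w, hw, ?_⟩
  rw [h, specRad, le_antisymm hle hge, ENNReal.toReal_ofReal hl0]

/-- A vector sequence with `v_{k+1} ≤ M v_k` decays at the rate of the spectral radius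
of the positive matrix `M`. -/
theorem exists_forall_le_mul_specRad_pow {m : ℕ} [NeZero m] {M : Matrix (Fin m) (Fin m) ℝ}
    (hM : ∀ i j, 0 < M i j) {v : ℕ → Fin m → ℝ} (hv : ∀ k i, v (k + 1) i ≤ (M *ᵥ v k) i) :
    ∃ C : ℝ, ∀ k i, v k i ≤ C * specRad M ^ k := by
  obtain ⟨w, hw, hMw⟩ := exists_pos_mulVec_eq_specRad_smul hM
  have hs : 0 ≤ specRad M := ENNReal.toReal_nonneg
  obtain ⟨i₀, hi₀⟩ := Finite.exists_max fun i => |v 0 i| / w i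
  set C := |v 0 i₀| / w i₀ with hC
  have hC0 : 0 ≤ C := div_nonneg (abs_nonneg _) (hw i₀).le
  have key : ∀ k i, v k i ≤ C * specRad M ^ k * w i := by
    intro k
    induction k with
    | zero =>
      intro i
      rw [pow_zero, mul_one]
      exact (le_abs_self _).trans ((div_le_iff₀ (hw i)).1 (hi₀ i))
    | succ k ih =>
      intro i
      calc v (k + 1) i ≤ ∑ j, M i j * v k j := hv k i
        _ ≤ ∑ j, M i j * (C * specRad M ^ k * w j) :=
          Finset.sum_le_sum fun j _ => mul_le_mul_of_nonneg_left (ih j) (hM i j).le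
        _ = C * specRad M ^ k * (M *ᵥ w) i := by
          simp only [Matrix.mulVec, dotProduct, Finset.mul_sum]
          exact Finset.sum_congr rfl fun j _ => by ring
        _ = _ := by rw [hMw, Pi.smul_apply, smul_eq_mul]; ring
  refine ⟨C * ∑ j, w j, fun k i => (key k i).trans ?_⟩
  rw [mul_right_comm]
  gcongr
  exact Finset.single_le_sum (f := w) (fun j _ => (hw j).le) (Finset.mem_univ i)

end Perron

/-! ### Weighted norms and mixing -/

section Dispersion

variable {ι E : Type*} [Fintype ι] [NormedAddCommGroup E] [InnerProductSpace ℝ E]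

/-- The weighted `ℓ²` norm `√(∑ i, ψ i ‖x i‖²)` of a family of vectors, for nonnegative weights
`ψ`. It is defined as the `ℓ²` norm of the rescaled family, which makes it a seminorm at once. -/
noncomputable def wnorm (ψ : ι → ℝ) (x : ι → E) : ℝ :=
  ‖(WithLp.toLp 2 (fun i => √(ψ i) • x i) : PiLp 2 fun _ : ι => E)‖

/-- The weighted mean `∑ i, ψ i x i`. -/
noncomputable def wmean (ψ : ι → ℝ) (x : ι → E) : E := ∑ i, ψ i • x i

theorem wnorm_nonneg (ψ : ι → ℝ) (x : ι → E) : 0 ≤ wnorm ψ x := norm_nonneg _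

theorem wnorm_sq {ψ : ι → ℝ} (hψ : ∀ i, 0 ≤ ψ i) (x : ι → E) :
    wnorm ψ x ^ 2 = ∑ i, ψ i * ‖x i‖ ^ 2 := by
  rw [wnorm, PiLp.norm_sq_eq_of_L2]
  refine Finset.sum_congr rfl fun i _ => ?_
  simp only [norm_smul, mul_pow, Real.norm_eq_abs, sq_abs, Real.sq_sqrt (hψ i)]

theorem wnorm_le {ψ : ι → ℝ} (hψ : ∀ i, 0 ≤ ψ i) {x : ι → E} {c : ℝ} (hc : 0 ≤ c)
    (h : ∑ i, ψ i * ‖x i‖ ^ 2 ≤ c ^ 2) : wnorm ψ x ≤ c :=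
  le_of_sq_le_sq (by rwa [wnorm_sq hψ]) hc

theorem wnorm_add_le (ψ : ι → ℝ) (x y : ι → E) :
    wnorm ψ (fun i => x i + y i) ≤ wnorm ψ x + wnorm ψ y := by
  simp only [wnorm, smul_add]
  exact norm_add_le (WithLp.toLp 2 (fun i => √(ψ i) • x i) : PiLp 2 fun _ : ι => E)
    (WithLp.toLp 2 (fun i => √(ψ i) • y i))

theorem wnorm_smul (ψ : ι → ℝ) (c : ℝ) (x : ι → E) :
    wnorm ψ (fun i => c • x i) = |c| * wnorm ψ x := by
  simp only [wnorm, smul_comm _ c]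
  rw [← Real.norm_eq_abs]
  exact norm_smul c (WithLp.toLp 2 (fun i => √(ψ i) • x i) : PiLp 2 fun _ : ι => E)

theorem wnorm_sub_le (ψ : ι → ℝ) (x y : ι → E) :
    wnorm ψ (fun i => x i - y i) ≤ wnorm ψ x + wnorm ψ y := by
  have h := wnorm_add_le ψ x fun i => (-1 : ℝ) • y i
  rw [wnorm_smul, abs_neg, abs_one, one_mul] at h
  simpa [sub_eq_add_neg] using h

/-- Comparison of two weighted norms, term by term. -/
theorem wnorm_le_mul_wnorm {ψ ω : ι → ℝ} (hψ : ∀ i, 0 ≤ ψ i) (hω : ∀ i, 0 ≤ ω i) {x y : ι → E}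
    {c : ℝ} (hc : 0 ≤ c) (h : ∀ i, ψ i * ‖x i‖ ^ 2 ≤ c ^ 2 * (ω i * ‖y i‖ ^ 2)) :
    wnorm ψ x ≤ c * wnorm ω y := by
  refine wnorm_le hψ (mul_nonneg hc (wnorm_nonneg _ _)) ?_
  rw [mul_pow, wnorm_sq hω, Finset.mul_sum]
  exact Finset.sum_le_sum fun i _ => h i

theorem wmean_add (ψ : ι → ℝ) (x y : ι → E) :
    wmean ψ (fun i => x i + y i) = wmean ψ x + wmean ψ y := by
  simp [wmean, smul_add, Finset.sum_add_distrib]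

theorem wmean_sub (ψ : ι → ℝ) (x y : ι → E) :
    wmean ψ (fun i => x i - y i) = wmean ψ x - wmean ψ y := by
  simp [wmean, smul_sub, Finset.sum_sub_distrib]

theorem wmean_smul (ψ : ι → ℝ) (c : ℝ) (x : ι → E) :
    wmean ψ (fun i => c • x i) = c • wmean ψ x := by
  simp [wmean, Finset.smul_sum, smul_comm c]

theorem wmean_const {ψ : ι → ℝ} (hψ : ∑ i, ψ i = 1) (u : E) : wmean ψ (fun _ => u) = u := by
  rw [wmean, ← Finset.sum_smul, hψ, one_smul]

/-- The bias-variance decomposition. -/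
theorem sum_mul_norm_sub_sq {ψ : ι → ℝ} (hψ : ∑ i, ψ i = 1) (x : ι → E) (u : E) :
    ∑ i, ψ i * ‖x i - u‖ ^ 2 =
      ∑ i, ψ i * ‖x i - wmean ψ x‖ ^ 2 + ‖wmean ψ x - u‖ ^ 2 := by
  set m := wmean ψ x with hm
  have h0 : ∑ i, ψ i * inner ℝ (x i - m) (m - u) = 0 := by
    have : ∑ i, ψ i • (x i - m) = 0 := by
      have := wmean_sub ψ x fun _ => m
      rwa [wmean_const hψ, ← hm, sub_self] at this
    calc ∑ i, ψ i * inner ℝ (x i - m) (m - u) = inner ℝ (∑ i, ψ i • (x i - m)) (m - u) := by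
          simp [sum_inner, inner_smul_left]
      _ = 0 := by rw [this, inner_zero_left]
  calc ∑ i, ψ i * ‖x i - u‖ ^ 2
      = ∑ i, (ψ i * ‖x i - m‖ ^ 2 + 2 * (ψ i * inner ℝ (x i - m) (m - u))
          + ψ i * ‖m - u‖ ^ 2) := by
        refine Finset.sum_congr rfl fun i _ => ?_
        rw [← sub_add_sub_cancel (x i) m u, norm_add_sq_real]
        ring
    _ = _ := by
        rw [Finset.sum_add_distrib, Finset.sum_add_distrib, ← Finset.mul_sum, h0,
          ← Finset.sum_mul, hψ]
        ring

theorem wnorm_sub_wmean_le {ψ : ι → ℝ} (hψ : ψ ∈ stdSimplex ℝ ι) (x : ι → E) (u : E) :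
    wnorm ψ (fun i => x i - wmean ψ x) ≤ wnorm ψ (fun i => x i - u) := by
  refine wnorm_le hψ.1 (wnorm_nonneg _ _) ?_
  rw [wnorm_sq hψ.1, sum_mul_norm_sub_sq hψ.2 x u]
  exact le_add_of_nonneg_right (sq_nonneg _)

theorem wnorm_sub_le_add {ψ : ι → ℝ} (hψ : ψ ∈ stdSimplex ℝ ι) (x : ι → E) (u : E) :
    wnorm ψ (fun i => x i - u) ≤
      wnorm ψ (fun i => x i - wmean ψ x) + ‖wmean ψ x - u‖ := by
  refine wnorm_le hψ.1 (add_nonneg (wnorm_nonneg _ _) (norm_nonneg _)) ?_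
  rw [sum_mul_norm_sub_sq hψ.2 x u, ← wnorm_sq hψ.1]
  nlinarith [wnorm_nonneg ψ (fun i => x i - wmean ψ x), norm_nonneg (wmean ψ x - u)]

theorem norm_wmean_le {ψ : ι → ℝ} (hψ : ψ ∈ stdSimplex ℝ ι) (x : ι → E) :
    ‖wmean ψ x‖ ≤ wnorm ψ x := by
  refine le_of_sq_le_sq ?_ (wnorm_nonneg _ _)
  have h := sum_mul_norm_sub_sq hψ.2 x 0
  simp only [sub_zero] at h
  rw [wnorm_sq hψ.1, h]
  exact le_add_of_nonneg_left (Finset.sum_nonneg fun i _ => mul_nonneg (hψ.1 i) (sq_nonneg _))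

/-- The dispersion as a sum over pairs. -/
theorem sum_sum_mul_norm_sub_sq {ψ : ι → ℝ} (hψ : ∑ i, ψ i = 1) (x : ι → E) :
    ∑ i, ∑ j, ψ i * ψ j * ‖x i - x j‖ ^ 2 =
      2 * ∑ i, ψ i * ‖x i - wmean ψ x‖ ^ 2 := by
  rw [Finset.sum_comm]
  have h : ∀ j, ∑ i, ψ i * ψ j * ‖x i - x j‖ ^ 2 =
      ψ j * (∑ i, ψ i * ‖x i - wmean ψ x‖ ^ 2) + ψ j * ‖x j - wmean ψ x‖ ^ 2 := by
    intro j
    rw [norm_sub_rev (x j), ← mul_add, ← sum_mul_norm_sub_sq hψ, Finset.mul_sum]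
    exact Finset.sum_congr rfl fun i _ => by ring
  simp_rw [h, Finset.sum_add_distrib, ← Finset.sum_mul, hψ]
  ring

/-- The dispersion bounds the part of the pair sum in which one of the two indices is `i`. -/
theorem mul_sum_norm_sub_sq_le {ψ : ι → ℝ} (hψ : ψ ∈ stdSimplex ℝ ι) (x : ι → E) (i : ι) :
    ∑ j, ψ j * ψ i * ‖x j - x i‖ ^ 2 ≤ ∑ j, ψ j * ‖x j - wmean ψ x‖ ^ 2 := by
  classical
  have hnn : ∀ j l, 0 ≤ ψ j * ψ l * ‖x j - x l‖ ^ 2 := fun j l =>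
    mul_nonneg (mul_nonneg (hψ.1 j) (hψ.1 l)) (sq_nonneg _)
  have h := sum_sum_mul_norm_sub_sq hψ.2 x
  rw [← Finset.add_sum_erase _ _ (Finset.mem_univ i)] at h
  have h1 : ∑ l, ψ i * ψ l * ‖x i - x l‖ ^ 2 = ∑ j, ψ j * ψ i * ‖x j - x i‖ ^ 2 :=
    Finset.sum_congr rfl fun l _ => by rw [norm_sub_rev, mul_comm (ψ i)]
  have h2 : ∑ j, ψ j * ψ i * ‖x j - x i‖ ^ 2 =
      ∑ j ∈ Finset.univ.erase i, ψ j * ψ i * ‖x j - x i‖ ^ 2 := by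
    rw [← Finset.add_sum_erase _ _ (Finset.mem_univ i)]
    simp
  have h3 : ∑ j ∈ Finset.univ.erase i, ψ j * ψ i * ‖x j - x i‖ ^ 2 ≤
      ∑ j ∈ Finset.univ.erase i, ∑ l, ψ j * ψ l * ‖x j - x l‖ ^ 2 :=
    Finset.sum_le_sum fun j _ =>
      Finset.single_le_sum (fun l _ => hnn j l) (Finset.mem_univ i)
  linarith

/-- Mixing by a row-stochastic matrix `W` decreases the dispersion by at least the weighted sum of
the squared differences along the edges. -/
theorem sum_mul_norm_mix_sub_sq_le {W : Matrix ι ι ℝ} (hW : ∀ i, W i ∈ stdSimplex ℝ ι)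
    {ψ ψ' : ι → ℝ} (hψ' : ∀ i, 0 ≤ ψ' i) (hψW : ∀ j, ∑ i, ψ' i * W i j = ψ j) (x : ι → E) (u : E) :
    ∑ i, ψ' i * ‖∑ j, W i j • x j - u‖ ^ 2
      + ∑ i, ∑ j, ψ' i * (W i j * W i i) * ‖x j - x i‖ ^ 2 ≤ ∑ j, ψ j * ‖x j - u‖ ^ 2 := by
  calc _ = ∑ i, ψ' i * (∑ j, W i j * W i i * ‖x j - x i‖ ^ 2
          + ‖∑ j, W i j • x j - u‖ ^ 2) := by
        rw [← Finset.sum_add_distrib]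
        refine Finset.sum_congr rfl fun i _ => ?_
        rw [mul_add, Finset.mul_sum, add_comm]
        simp only [mul_assoc]
    _ ≤ ∑ i, ψ' i * ∑ j, W i j * ‖x j - u‖ ^ 2 := by
        refine Finset.sum_le_sum fun i _ => mul_le_mul_of_nonneg_left ?_ (hψ' i)
        rw [sum_mul_norm_sub_sq (hW i).2 x u]
        have := mul_sum_norm_sub_sq_le (hW i) x i
        gcongr
        exact le_rfl
    _ = ∑ j, ψ j * ‖x j - u‖ ^ 2 := by
        simp_rw [Finset.mul_sum, ← hψW, Finset.sum_mul]
        rw [Finset.sum_comm]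
        simp only [mul_assoc]

/-- The contraction of the dispersion by one mixing step on a strongly connected graph. The
dispersion is half of a sum over ordered pairs of nodes, while the loss from mixing counts every
edge in full, so the decrease is *twice* the one in the constants `c_k` and `τ_k`: with `θ` the
subtracted fraction, the squared factor is `1 - 2 θ ≤ (1 - θ) ^ 2`, and `1 - θ ≤ c ^ 2` gives the
factor `c ^ 2` instead of `c`. -/
theorem wnorm_mix_sub_wmean_le [DecidableEq ι] {G : Digraph ι} (hG : StronglyConnected G)
    {W : Matrix ι ι ℝ} (hW : ∀ i, W i ∈ stdSimplex ℝ ι) {ψ ψ' : ι → ℝ}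
    (hψ : ψ ∈ stdSimplex ℝ ι) (hψ' : ∀ i, 0 ≤ ψ' i) (hψW : ∀ j, ∑ i, ψ' i * W i j = ψ j)
    {κ m c : ℝ} (hκ : ∀ i j, G.Adj j i → κ ≤ ψ' i * (W i j * W i i)) (hκ0 : 0 ≤ κ)
    (hm : ∀ i, ψ i ≤ m) (hc : √(1 - κ / (m ^ 2 * diameter G * maxEdgeUtility G)) ≤ c)
    (x : ι → E) :
    wnorm ψ' (fun i => ∑ j, W i j • x j - wmean ψ x) ≤
      c ^ 2 * wnorm ψ (fun i => x i - wmean ψ x) := by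
  classical
  have hψm : ∑ i, ∑ j, ψ i * ψ j * ‖x i - x j‖ ^ 2 ≤ m ^ 2 * ∑ i, ∑ j, ‖x i - x j‖ ^ 2 := by
    simp only [Finset.mul_sum]
    refine Finset.sum_le_sum fun i _ => Finset.sum_le_sum fun j _ => ?_
    rw [sq m]
    have := (hψ.1 i).trans (hm i)
    exact mul_le_mul_of_nonneg_right (mul_le_mul (hm i) (hm j) (hψ.1 j) this) (sq_nonneg _)
  set X := m ^ 2 * diameter G * maxEdgeUtility G with hX
  have hX0 : 0 ≤ X := by positivity
  set S := ∑ e : ι × ι with G.Adj e.1 e.2, ‖x e.1 - x e.2‖ ^ 2 with hS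
  set d := ∑ i, ψ i * ‖x i - wmean ψ x‖ ^ 2 with hd
  have hd0 : 0 ≤ d := Finset.sum_nonneg fun i _ => mul_nonneg (hψ.1 i) (sq_nonneg _)
  have hS0 : 0 ≤ S := Finset.sum_nonneg fun i _ => sq_nonneg _
  have hdS : 2 * d ≤ X * S := by
    rw [hd, ← sum_sum_mul_norm_sub_sq hψ.2]
    refine hψm.trans ?_
    rw [hX, mul_assoc (m ^ 2), mul_assoc (m ^ 2)]
    exact mul_le_mul_of_nonneg_left (sum_norm_sub_sq_le hG x) (sq_nonneg m)
  have hκS : κ * S ≤ ∑ i, ∑ j, ψ' i * (W i j * W i i) * ‖x j - x i‖ ^ 2 := by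
    have hnn : ∀ q : ι × ι, 0 ≤ ψ' q.2 * (W q.2 q.1 * W q.2 q.2) * ‖x q.1 - x q.2‖ ^ 2 := fun q =>
      mul_nonneg (mul_nonneg (hψ' _) (mul_nonneg ((hW _).1 _) ((hW _).1 _))) (sq_nonneg _)
    rw [Finset.sum_comm,
      ← Fintype.sum_prod_type' fun j i => ψ' i * (W i j * W i i) * ‖x j - x i‖ ^ 2, hS,
      Finset.mul_sum]
    refine (Finset.sum_le_sum fun e he => ?_).trans
      (Finset.sum_le_sum_of_subset_of_nonneg (Finset.filter_subset _ _) fun q _ _ => hnn q)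
    exact mul_le_mul_of_nonneg_right (hκ _ _ (Finset.mem_filter.1 he).2) (sq_nonneg _)
  have hmix := sum_mul_norm_mix_sub_sq_le hW hψ' hψW x (wmean ψ x)
  obtain ⟨hc0, hc1⟩ := Real.sqrt_le_iff.1 hc
  refine wnorm_le hψ' (mul_nonneg (sq_nonneg c) (wnorm_nonneg _ _)) ?_
  rw [mul_pow, wnorm_sq hψ.1, ← hd]
  have hθ : κ / X * (2 * d) ≤ κ * S := by
    rcases hX0.eq_or_lt with h0 | h0
    · rw [← h0, div_zero, zero_mul]; positivity
    · calc κ / X * (2 * d) ≤ κ / X * (X * S) := by gcongr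
        _ = κ * S := by field_simp
  have hcc : 1 - 2 * (κ / X) ≤ (c ^ 2) ^ 2 := by nlinarith [sq_nonneg (c ^ 2 - 1)]
  nlinarith [mul_le_mul_of_nonneg_right hcc hd0]

end Dispersion

/-! ### The stochastic vectors -/

section StochasticVectors

/-- A path that ends in a set but does not start in it has an edge that enters the set. -/
theorem DiPath.exists_adj_not_mem_mem {V : Type*} {G : Digraph V} {u v : V} (q : DiPath G u v)
    {S : Set V} (hu : u ∉ S) (hv : v ∈ S) : ∃ j i, G.Adj j i ∧ j ∉ S ∧ i ∈ S := by
  induction q with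
  | nil u => exact absurd hv hu
  | @cons u v w h q ih =>
    by_cases hvS : v ∈ S
    · exact ⟨u, v, h, hu, hvS⟩
    · exact ih hvS hv

variable {n : ℕ} {G : ℕ → Digraph (Fin n)} {A : ℕ → Matrix (Fin n) (Fin n) ℝ}

/-- All entries of `φ k` are positive: going from `φ (k + 1)` to `φ k`, the support keeps its
elements, as the diagonal of `A k` is positive, and gains one while it is not everything, as `G k`
is strongly connected. -/
theorem IsAbsProb.pos {φ : ℕ → Fin n → ℝ} (hφ : IsAbsProb A φ)
    (hG : ∀ k, StronglyConnected (G k)) (hA : ∀ k, A k ∈ Matrix.rowStochastic ℝ (Fin n))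
    (hAG : ∀ k, Compatible (G k) (A k)) (k : ℕ) (i : Fin n) : 0 < φ k i := by
  let S : ℕ → Finset (Fin n) := fun k => Finset.univ.filter fun i => 0 < φ k i
  have hSne : ∀ k, (S k).Nonempty := by
    intro k
    by_contra h
    have h0 : ∀ i, φ k i ≤ 0 := fun i => by
      by_contra hi
      exact h ⟨i, by simpa [S] using hi⟩
    have := (hφ.1 k).2
    have h1 := Finset.sum_nonpos fun i (_ : i ∈ Finset.univ) => h0 i
    linarith
  have hstep : ∀ k i j, i ∈ S (k + 1) → 0 < A k i j → j ∈ S k := by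
    intro k i j hi hij
    simp only [S, Finset.mem_filter, Finset.mem_univ, true_and] at hi ⊢
    rw [← hφ.2 k, Matrix.vecMul, dotProduct]
    exact Finset.sum_pos' (fun l _ => mul_nonneg ((hφ.1 _).1 l)
      (Matrix.nonneg_of_mem_rowStochastic (hA k))) ⟨i, Finset.mem_univ _, mul_pos hi hij⟩
  have hcard : ∀ m k, min n (m + 1) ≤ (S k).card := by
    intro m
    induction m with
    | zero => exact fun k => (min_le_right _ _).trans (Finset.card_pos.2 (hSne k))
    | succ m ih =>
      intro k
      have hsub : S (k + 1) ⊆ S k := fun i hi => hstep k i i hi (((hAG k) i i).1 (Or.inr rfl))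
      have hk := ih (k + 1)
      by_cases huniv : S (k + 1) = Finset.univ
      · have : S k = Finset.univ := Finset.univ_subset_iff.1 (huniv ▸ hsub)
        simp [this]
      · obtain ⟨v, hv⟩ := hSne (k + 1)
        obtain ⟨u, hu⟩ : ∃ u, u ∉ S (k + 1) := by
          by_contra! h
          exact huniv (Finset.eq_univ_iff_forall.2 h)
        obtain ⟨q⟩ := hG k u v
        obtain ⟨j, i, hji, hj, hi⟩ := q.exists_adj_not_mem_mem (S := (S (k + 1) : Set (Fin n)))
          (by simpa using hu) (by simpa using hv)
        have hj' : j ∈ S k := hstep k i j hi (((hAG k) i j).1 (Or.inl hji))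
        have hlt := Finset.card_lt_card
          (Finset.ssubset_iff_subset_ne.2 ⟨hsub, fun h => hj (by rw [h]; exact hj')⟩)
        omega
  have hn : (S k).card = Fintype.card (Fin n) := by
    have h1 := hcard n k
    have h2 := Finset.card_le_univ (S k)
    simp only [Fintype.card_fin] at h2 ⊢
    omega
  have := Finset.eq_univ_iff_forall.1 ((Finset.card_eq_iff_eq_univ _).1 hn) i
  simpa [S] using this

theorem piVec_mem_stdSimplex {B : ℕ → Matrix (Fin n) (Fin n) ℝ} (hn : 0 < n)
    (hB : ∀ k, B k ∈ Matrix.colStochastic ℝ (Fin n)) (k : ℕ) :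
    piVec B k ∈ stdSimplex ℝ (Fin n) := by
  induction k with
  | zero =>
    have : (n : ℝ) ≠ 0 := by positivity
    exact ⟨fun i => by simp [piVec], by simp [piVec, this]⟩
  | succ k ih =>
    refine ⟨fun i => ?_, ?_⟩
    · simp only [piVec, Matrix.mulVec, dotProduct]
      exact Finset.sum_nonneg fun j _ =>
        mul_nonneg (Matrix.nonneg_of_mem_colStochastic (hB k)) (ih.1 j)
    · simp only [piVec, Matrix.mulVec, dotProduct]
      rw [Finset.sum_comm]
      simp_rw [← Finset.sum_mul, Matrix.sum_col_of_mem_colStochastic (hB k), one_mul]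
      exact ih.2

theorem minEntry_le (v : Fin n → ℝ) (i : Fin n) : minEntry v ≤ v i :=
  ciInf_le (Set.finite_range v).bddBelow i

theorem le_maxEntry (v : Fin n → ℝ) (i : Fin n) : v i ≤ maxEntry v :=
  le_ciSup (Set.finite_range v).bddAbove i

theorem minEntry_pos [NeZero n] {v : Fin n → ℝ} (hv : ∀ i, 0 < v i) : 0 < minEntry v := by
  obtain ⟨i, hi⟩ := exists_eq_ciInf_of_finite (f := v)
  rw [minEntry, ← hi]
  exact hv i

end StochasticVectors

/-! ### The comparison matrix -/

section ComparisonMatrix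

open Matrix

variable {n : ℕ} {L μ c τ r ϕ σ α : ℝ}

theorem compMatrix_pos [NeZero n] (hL : 0 < L) (hc : 0 < c) (hτ : 0 < τ) (hr : 0 < r)
    (hϕ : 0 < ϕ) (hα : 0 < α) (h1 : α * n * σ * μ < 1) (i j : Fin 3) :
    0 < compMatrix n L μ c τ r ϕ σ α i j := by
  have hn : 0 < √(n : ℝ) := Real.sqrt_pos.2 (Nat.cast_pos.2 (NeZero.pos n))
  fin_cases i <;> fin_cases j <;> simp [compMatrix] <;> first | positivity | linarith

/-- The stepsize bound makes the spectral radius less than one. With `β = L √n ϕ`, `m = n σ μ` and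
`H = L r ((1 + c) ϕ + (1 - c))`, one has `det (1 - M(α)) = α (m (1 - c) (1 - τ) - α η)`. A positive
vector `w` with `M(α) w < w` is obtained by taking `w₁ = 1 - τ` and `w₂ = H`, for which the third
inequality is `L r` times the second, and then `w₀` slightly above the bound
`(β (1 - τ) + H) / m` given by the first one. -/
theorem specRad_compMatrix_lt_one [NeZero n] (hL : 0 < L) (hc : c ∈ Set.Ioo (0 : ℝ) 1)
    (hτ : τ ∈ Set.Ioo (0 : ℝ) 1) (hr : 0 < r) (hϕ : 0 < ϕ) (hα : 0 < α) (hσ : 0 < σ) (hμ : 0 < μ)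
    (h1 : α * n * σ * μ < 1)
    (hη : α * eta n L μ c τ r ϕ σ < n * σ * μ * (1 - τ) * (1 - c)) :
    specRad (compMatrix n L μ c τ r ϕ σ α) < 1 := by
  obtain ⟨hc0, hc1⟩ := hc
  obtain ⟨hτ0, hτ1⟩ := hτ
  have hn : 0 < (n : ℝ) := Nat.cast_pos.2 (NeZero.pos n)
  have hsn : 0 < √(n : ℝ) := Real.sqrt_pos.2 hn
  have hc1' : 0 < 1 - c := by linarith
  have hτ1' : 0 < 1 - τ := by linarith
  set β := L * √(n : ℝ) * ϕ with hβ
  set m := n * σ * μ with hm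
  set H := L * r * (1 + c) * ϕ + L * r * (1 - c) with hH
  set Q := β * (1 - τ) + H with hQ
  have hβ0 : 0 < β := by positivity
  have hm0 : 0 < m := by positivity
  have hH0 : 0 < H := by positivity
  have hQ0 : 0 < Q := by positivity
  have heta : eta n L μ c τ r ϕ σ = (m + β) * Q := by
    rw [eta, hQ, hβ, hH, hm]; ring
  rw [heta] at hη
  set s := m * (1 - τ) * (1 - c) - α * ((m + β) * Q) with hs
  have hs0 : 0 < s := sub_pos.2 hη
  set ε := s / (2 * α * β) with hε
  have hε0 : 0 < ε := by positivity
  have hεs : α * β * ε = s / 2 := by rw [hε]; field_simp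
  set u := (Q + ε) / m with hu
  have hu0 : 0 < u := by positivity
  have hmu : m * u = Q + ε := by rw [hu]; field_simp
  have hrow : α * (β * u + β * (1 - τ) + H) < (1 - c) * (1 - τ) := by
    refine lt_of_mul_lt_mul_left (a := m) ?_ hm0.le
    have : m * (α * (β * u + β * (1 - τ) + H)) = α * (β * (m * u) + m * Q) := by rw [hQ]; ring
    rw [this, hmu]
    have : α * (β * (Q + ε) + m * Q) = α * ((m + β) * Q) + α * β * ε := by ring
    rw [this, hεs]
    linarith
  refine specRad_lt_one
    (fun i j => (compMatrix_pos hL hc0 hτ0 hr hϕ hα h1 i j).le) (w := ![u, 1 - τ, H]) ?_ ?_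
  · intro i
    fin_cases i <;> simp <;> linarith
  · have e0 : α * n * σ * μ = α * m := by rw [hm]; ring
    have e1 : α * L * √(n : ℝ) * ϕ = α * β := by rw [hβ]; ring
    have e2 : α * L ^ 2 * r * √(n : ℝ) * ϕ = L * r * (α * β) := by rw [hβ]; ring
    have hLr : 0 < L * r := by positivity
    have r0 : (1 - α * m) * u + α * β * (1 - τ) + α * H < u := by
      have h1 : α * (m * u) = α * (Q + ε) := by rw [hmu]
      have h2 : 0 < α * ε := by positivity
      have h3 : α * Q = α * β * (1 - τ) + α * H := by rw [hQ]; ring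
      linarith
    have r1 : α * β * u + (c + α * β) * (1 - τ) + α * H < 1 - τ := by linarith
    have r2 : L * r * (α * β) * u + (L * r * (1 + c) * ϕ + L * r * (α * β)) * (1 - τ)
        + (τ + α * L * r) * H < H := by
      have h1 := mul_lt_mul_of_pos_left hrow hLr
      have h2 : (1 - τ) * H = L * r * (1 + c) * ϕ * (1 - τ) + L * r * ((1 - c) * (1 - τ)) := by
        rw [hH]; ring
      linarith
    intro i
    simp only [compMatrix, mulVec, dotProduct, Fin.sum_univ_three, e0, e1, e2]
    fin_cases i
    · exact r0
    · exact r1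
    · exact r2

end ComparisonMatrix

/-! ### One step of the error recursion -/

section OneStep

variable {n : ℕ} {E : Type*} [NormedAddCommGroup E] [InnerProductSpace ℝ E]

theorem sum_norm_le_mul_wnorm {ψ : Fin n → ℝ} (hψ : ∀ i, 0 ≤ ψ i) {R : ℝ} (hR : 0 ≤ R)
    (hψR : ∀ i, 1 ≤ R ^ 2 * ψ i) (z : Fin n → E) :
    ∑ i, ‖z i‖ ≤ √(n : ℝ) * R * wnorm ψ z := by
  refine le_of_sq_le_sq ?_ (by have := wnorm_nonneg ψ z; positivity)
  rw [mul_pow, mul_pow, Real.sq_sqrt (Nat.cast_nonneg n), wnorm_sq hψ, mul_assoc, Finset.mul_sum]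
  calc (∑ i, ‖z i‖) ^ 2 ≤ (Finset.univ : Finset (Fin n)).card * ∑ i, ‖z i‖ ^ 2 :=
        sq_sum_le_card_mul_sum_sq
    _ ≤ n * ∑ i, R ^ 2 * (ψ i * ‖z i‖ ^ 2) := by
        rw [Finset.card_univ, Fintype.card_fin]
        refine mul_le_mul_of_nonneg_left (Finset.sum_le_sum fun i _ => ?_) (Nat.cast_nonneg n)
        rw [← mul_assoc]
        exact le_mul_of_one_le_left (sq_nonneg _) (hψR i)

/-- The sum of the gradients along `x` differs from that at the point `u` by at most
`L √n R` times the weighted distance. -/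
theorem norm_sum_sub_sum_le {g : Fin n → E → E} {L : ℝ} (hL : 0 < L)
    (hg : ∀ i x u, ‖g i x - g i u‖ ≤ L * ‖x - u‖) {ψ : Fin n → ℝ} (hψ : ∀ i, 0 ≤ ψ i) {R : ℝ}
    (hR : 0 ≤ R) (hψR : ∀ i, 1 ≤ R ^ 2 * ψ i) (x : Fin n → E) (u : E) :
    ‖∑ i, g i (x i) - ∑ i, g i u‖ ≤ L * √(n : ℝ) * R * wnorm ψ (fun i => x i - u) := by
  rw [← Finset.sum_sub_distrib]
  calc ‖∑ i, (g i (x i) - g i u)‖ ≤ ∑ i, L * ‖x i - u‖ :=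
        (norm_sum_le _ _).trans (Finset.sum_le_sum fun i _ => hg i _ _)
    _ = L * ∑ i, ‖x i - u‖ := by rw [Finset.mul_sum]
    _ ≤ L * (√(n : ℝ) * R * wnorm ψ (fun i => x i - u)) := by
        gcongr
        exact sum_norm_le_mul_wnorm hψ hR hψR _
    _ = _ := by ring

theorem le_one_of_mem_stdSimplex {ι : Type*} [Fintype ι] {ψ : ι → ℝ} (hψ : ψ ∈ stdSimplex ℝ ι)
    (i : ι) : ψ i ≤ 1 := by
  rw [← hψ.2]
  exact Finset.single_le_sum (fun i _ => hψ.1 i) (Finset.mem_univ i)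

/-- The tracking error weighted twice: an extra factor `π i` only decreases the norm. -/
theorem wnorm_smul_le {ω π : Fin n → ℝ} (hω : ∀ i, 0 ≤ ω i) (hω1 : ∀ i, ω i ≤ 1)
    (hπ : π ∈ stdSimplex ℝ (Fin n)) (z : Fin n → E) :
    wnorm ω (fun i => π i • z i) ≤ wnorm π z := by
  have h := wnorm_le_mul_wnorm hω hπ.1 (x := fun i => π i • z i) (y := z) zero_le_one fun i => by
    rw [norm_smul, mul_pow, Real.norm_eq_abs, sq_abs, one_pow, one_mul, ← mul_assoc]
    have h1 := hω1 i
    have h2 := hπ.1 i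
    have h3 := le_one_of_mem_stdSimplex hπ i
    have h4 : ω i * π i ^ 2 ≤ π i := by nlinarith [mul_le_mul_of_nonneg_right h1 (sq_nonneg (π i))]
    gcongr
  rwa [one_mul] at h

/-- The directions `y` are bounded by their tracking error and their sum. -/
theorem wnorm_le_add_norm_sum {ω π : Fin n → ℝ} (hω : ∀ i, 0 ≤ ω i) (hω1 : ∀ i, ω i ≤ 1)
    (hπ : π ∈ stdSimplex ℝ (Fin n)) (hπ0 : ∀ i, 0 < π i) (y : Fin n → E) (s : E) :
    wnorm ω y ≤ wnorm π (fun i => (π i)⁻¹ • y i - s) + ‖s‖ := by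
  have h : y = fun i => π i • ((π i)⁻¹ • y i - s) + π i • s := by
    ext i
    rw [smul_sub, smul_inv_smul₀ (hπ0 i).ne', sub_add_cancel]
  have hs : wnorm π (fun _ => s) ≤ ‖s‖ := wnorm_le hπ.1 (norm_nonneg _) (by
    rw [← Finset.sum_mul, hπ.2, one_mul])
  calc wnorm ω y = wnorm ω (fun i => π i • ((π i)⁻¹ • y i - s) + π i • s) := by rw [← h]
    _ ≤ wnorm ω (fun i => π i • ((π i)⁻¹ • y i - s)) + wnorm ω (fun i => π i • s) :=
      wnorm_add_le _ _ _
    _ ≤ _ := add_le_add (wnorm_smul_le hω hω1 hπ _) ((wnorm_smul_le hω hω1 hπ _).trans hs)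

variable {A : Matrix (Fin n) (Fin n) ℝ} {φ φ' π : Fin n → ℝ} {x y : Fin n → E} {xs : E}
  {g : Fin n → E → E} {L μ α R σ : ℝ}

theorem wmean_mix (hφA : ∀ j, ∑ i, φ' i * A i j = φ j) (x : Fin n → E) :
    wmean φ' (fun i => ∑ j, A i j • x j) = wmean φ x := by
  simp only [wmean, ← hφA, Finset.smul_sum, Finset.sum_smul, smul_smul]
  rw [Finset.sum_comm]

/-- The weighted mean moves by a gradient step of the average objective with the step
`α n ⟨φ', π⟩`, which lies between `α n σ` and `α n`, up to the consensus and tracking errors. -/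
theorem norm_wmean_step_le [NeZero n] (hφ : φ ∈ stdSimplex ℝ (Fin n))
    (hφ' : φ' ∈ stdSimplex ℝ (Fin n)) (hφA : ∀ j, ∑ i, φ' i * A i j = φ j) (hR : 0 ≤ R)
    (hφR : ∀ i, 1 ≤ R ^ 2 * φ i) (hπ : π ∈ stdSimplex ℝ (Fin n)) (hσ : 0 < σ) (hπσ : ∀ i, σ ≤ π i)
    (hL : 0 < L) (hμ : 0 < μ) (hα : 0 < α) (hg : ∀ i x u, ‖g i x - g i u‖ ≤ L * ‖x - u‖)
    (hstep : ∀ h, 0 ≤ h → h ≤ 2 / (L + μ) → ∀ x,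
      ‖x - h • ((1 / (n : ℝ)) • ∑ i, g i x) - xs‖ ≤ (1 - h * μ) * ‖x - xs‖)
    (hα2 : α ≤ 2 / (n * (L + μ))) (hy : ∑ i, y i = ∑ i, g i (x i)) :
    ‖wmean φ' (fun i => ∑ j, A i j • x j - α • y i) - xs‖ ≤
      (1 - α * n * σ * μ) * ‖wmean φ x - xs‖
        + α * L * √(n : ℝ) * R * wnorm φ (fun i => x i - wmean φ x)
        + α * wnorm π (fun i => (π i)⁻¹ • y i - ∑ j, y j) := by
  have hn : 0 < (n : ℝ) := Nat.cast_pos.2 (NeZero.pos n)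
  have hπ0 : ∀ i, 0 < π i := fun i => hσ.trans_le (hπσ i)
  set m := wmean φ x with hm
  set s := ∑ j, y j with hs
  set q := ∑ i, φ' i * π i with hq
  set z : Fin n → E := fun i => (π i)⁻¹ • y i - s with hz
  have hqσ : σ ≤ q := by
    calc σ = ∑ i, φ' i * σ := by rw [← Finset.sum_mul, hφ'.2, one_mul]
      _ ≤ q := Finset.sum_le_sum fun i _ => mul_le_mul_of_nonneg_left (hπσ i) (hφ'.1 i)
  have hq1 : q ≤ 1 := by
    calc q ≤ ∑ i, φ' i * 1 := Finset.sum_le_sum fun i _ =>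
          mul_le_mul_of_nonneg_left (le_one_of_mem_stdSimplex hπ i) (hφ'.1 i)
      _ = 1 := by simp [hφ'.2]
  have hq0 : 0 ≤ q := hσ.le.trans hqσ
  have hmy : wmean φ' y = wmean φ' (fun i => π i • z i) + q • s := by
    have h : y = fun i => π i • z i + π i • s := by
      ext i
      rw [hz, smul_sub, smul_inv_smul₀ (hπ0 i).ne', sub_add_cancel]
    conv_lhs => rw [h]
    rw [wmean_add]
    congr 1
    rw [wmean, hq, Finset.sum_smul]
    exact Finset.sum_congr rfl fun i _ => by rw [smul_smul]
  have hdecomp : wmean φ' (fun i => ∑ j, A i j • x j - α • y i) - xs =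
      (m - (α * q * n) • ((1 / (n : ℝ)) • ∑ i, g i m) - xs)
        - (α * q) • (∑ i, g i (x i) - ∑ i, g i m) - α • wmean φ' (fun i => π i • z i) := by
    have e1 : (α * q * n) • ((1 / (n : ℝ)) • ∑ i, g i m) = (α * q) • ∑ i, g i m := by
      rw [smul_smul]; congr 1; field_simp
    rw [wmean_sub, wmean_smul, wmean_mix hφA, hmy, e1, ← hy]
    module
  have h1 : ‖m - (α * q * n) • ((1 / (n : ℝ)) • ∑ i, g i m) - xs‖ ≤
      (1 - α * n * σ * μ) * ‖m - xs‖ := by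
    refine (hstep _ (by positivity) ?_ m).trans ?_
    · rw [le_div_iff₀ (by positivity)] at hα2 ⊢
      calc α * q * n * (L + μ) ≤ α * 1 * n * (L + μ) := by gcongr
        _ ≤ 2 := by linarith
    · have : α * n * σ * μ ≤ α * q * n * μ := by
        rw [mul_right_comm α q]; gcongr
      gcongr
  have h2 : ‖(α * q) • (∑ i, g i (x i) - ∑ i, g i m)‖ ≤
      α * L * √(n : ℝ) * R * wnorm φ (fun i => x i - m) := by
    rw [norm_smul, Real.norm_of_nonneg (by positivity)]
    calc _ ≤ (α * 1) * (L * √(n : ℝ) * R * wnorm φ (fun i => x i - m)) := by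
          gcongr
          exact norm_sum_sub_sum_le hL hg hφ.1 hR hφR x m
      _ = _ := by ring
  have h3 : ‖α • wmean φ' (fun i => π i • z i)‖ ≤ α * wnorm π z := by
    rw [norm_smul, Real.norm_of_nonneg hα.le]
    gcongr
    exact (norm_wmean_le hφ' _).trans
      (wnorm_smul_le hφ'.1 (le_one_of_mem_stdSimplex hφ') hπ z)
  rw [hdecomp]
  calc _ ≤ _ := (norm_sub_le _ _).trans (add_le_add_left (norm_sub_le _ _) _)
    _ ≤ _ := add_le_add (add_le_add h1 h2) h3

/-- The sum of the directions is the sum of the local gradients, which vanishes at the minimizer. -/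
theorem norm_sum_directions_le (hφ : φ ∈ stdSimplex ℝ (Fin n)) (hR : 0 ≤ R)
    (hφR : ∀ i, 1 ≤ R ^ 2 * φ i) (hL : 0 < L) (hg : ∀ i x u, ‖g i x - g i u‖ ≤ L * ‖x - u‖)
    (hxs : ∑ i, g i xs = 0) (hy : ∑ i, y i = ∑ i, g i (x i)) :
    ‖∑ i, y i‖ ≤ L * √(n : ℝ) * R *
      (wnorm φ (fun i => x i - wmean φ x) + ‖wmean φ x - xs‖) := by
  have h := norm_sum_sub_sum_le hL hg hφ.1 hR hφR x xs
  rw [hxs, sub_zero, ← hy] at h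
  refine h.trans ?_
  gcongr
  exact wnorm_sub_le_add hφ x xs

/-- The recursion for the consensus error. -/
theorem wnorm_consensus_step_le {c : ℝ} (hφ : φ ∈ stdSimplex ℝ (Fin n))
    (hφ' : φ' ∈ stdSimplex ℝ (Fin n)) (hR : 0 ≤ R)
    (hφR : ∀ i, 1 ≤ R ^ 2 * φ i) (hπ : π ∈ stdSimplex ℝ (Fin n)) (hπ0 : ∀ i, 0 < π i)
    (hL : 0 < L) (hα : 0 < α) (hg : ∀ i x u, ‖g i x - g i u‖ ≤ L * ‖x - u‖)
    (hxs : ∑ i, g i xs = 0) (hy : ∑ i, y i = ∑ i, g i (x i))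
    (hc : wnorm φ' (fun i => ∑ j, A i j • x j - wmean φ x) ≤
      c * wnorm φ (fun i => x i - wmean φ x))
    {x' : Fin n → E} (hx' : ∀ i, x' i = ∑ j, A i j • x j - α • y i) :
    wnorm φ' (fun i => x' i - wmean φ' x') ≤
      α * L * √(n : ℝ) * R * ‖wmean φ x - xs‖
        + (c + α * L * √(n : ℝ) * R) * wnorm φ (fun i => x i - wmean φ x)
        + α * wnorm π (fun i => (π i)⁻¹ • y i - ∑ j, y j) := by
  have h1 := wnorm_sub_wmean_le hφ' x' (wmean φ x)
  have h2 : wnorm φ' (fun i => x' i - wmean φ x) ≤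
      wnorm φ' (fun i => ∑ j, A i j • x j - wmean φ x) + α * wnorm φ' y := by
    have h := wnorm_sub_le φ' (fun i => ∑ j, A i j • x j - wmean φ x) fun i => α • y i
    rw [wnorm_smul, abs_of_pos hα] at h
    refine le_trans (le_of_eq ?_) h
    congr 1
    ext i
    rw [hx' i]
    abel
  have h3 := wnorm_le_add_norm_sum hφ'.1 (le_one_of_mem_stdSimplex hφ') hπ hπ0 y (∑ j, y j)
  have h4 := norm_sum_directions_le hφ hR hφR hL hg hxs hy
  have h5 := mul_le_mul_of_nonneg_left (h3.trans (add_le_add_right h4 _)) hα.le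
  calc _ ≤ _ := h1.trans (h2.trans (add_le_add hc h5))
    _ = _ := by ring

/-- The recursion for the tracking error: the change of the gradients is bounded by the movement
of the points, which is compared with their weighted mean before and after mixing. -/
theorem wnorm_tracking_step_le {B : Matrix (Fin n) (Fin n) ℝ} {π' : Fin n → ℝ} {c τ r : ℝ}
    (hφ : φ ∈ stdSimplex ℝ (Fin n))
    (hφ' : φ' ∈ stdSimplex ℝ (Fin n)) (hR : 0 ≤ R)
    (hφR : ∀ i, 1 ≤ R ^ 2 * φ i) (hφR' : ∀ i, 1 ≤ R ^ 2 * φ' i)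
    (hπ : π ∈ stdSimplex ℝ (Fin n)) (hπ0 : ∀ i, 0 < π i)
    (hπ' : π' ∈ stdSimplex ℝ (Fin n)) (hπ0' : ∀ i, 0 < π' i)
    (hB : ∀ j, ∑ i, B i j = 1)
    (hr : ∀ i, √(n : ℝ) + 1 / √(π' i) ≤ r)
    (hL : 0 < L) (hα : 0 < α) (hg : ∀ i x u, ‖g i x - g i u‖ ≤ L * ‖x - u‖)
    (hxs : ∑ i, g i xs = 0) (hy : ∑ i, y i = ∑ i, g i (x i))
    (hc : wnorm φ' (fun i => ∑ j, A i j • x j - wmean φ x) ≤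
      c * wnorm φ (fun i => x i - wmean φ x))
    (hτ : wnorm π' (fun i => (π' i)⁻¹ • (∑ j, B i j • y j) - ∑ j, y j) ≤
      τ * wnorm π (fun i => (π i)⁻¹ • y i - ∑ j, y j))
    {x' y' : Fin n → E} (hx' : ∀ i, x' i = ∑ j, A i j • x j - α • y i)
    (hy' : ∀ i, y' i = ∑ j, B i j • y j + g i (x' i) - g i (x i)) :
    wnorm π' (fun i => (π' i)⁻¹ • y' i - ∑ j, y' j) ≤
      α * L ^ 2 * r * √(n : ℝ) * R * ‖wmean φ x - xs‖
        + (L * r * (1 + c) * R + α * L ^ 2 * r * √(n : ℝ) * R) *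
          wnorm φ (fun i => x i - wmean φ x)
        + (τ + α * L * r) * wnorm π (fun i => (π i)⁻¹ • y i - ∑ j, y j) := by
  have hone : ∀ i : Fin n, (0 : ℝ) ≤ (fun _ => 1 : Fin n → ℝ) i := fun _ => zero_le_one
  have hr0 : √(n : ℝ) ≤ r := by
    by_contra! h
    rcases isEmpty_or_nonempty (Fin n) with he | ⟨⟨i⟩⟩
    · simpa using hπ.2
    · have : 0 ≤ 1 / √(π' i) := by positivity
      linarith [hr i]
  set d : Fin n → E := fun i => g i (x' i) - g i (x i) with hd
  set s := ∑ j, y j with hs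
  set N := wnorm (fun _ => 1) d with hN
  have hsum : ∑ j, y' j = s + ∑ j, d j := by
    have h : ∀ j, y' j = ∑ l, B j l • y l + d j := fun j => by rw [hy', add_sub_assoc]
    simp_rw [h, Finset.sum_add_distrib]
    congr 1
    rw [Finset.sum_comm]
    simp_rw [← Finset.sum_smul, hB, one_smul]
    rfl
  have hN0 : 0 ≤ N := wnorm_nonneg _ _
  -- the perturbation of the tracking error by the change `d` of the gradients
  have h1 : wnorm π' (fun i => (π' i)⁻¹ • d i) ≤ (r - √(n : ℝ)) * N := by
    refine wnorm_le_mul_wnorm hπ'.1 hone (sub_nonneg.2 hr0) fun i => ?_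
    have hsq : 1 ≤ (r - √(n : ℝ)) ^ 2 * π' i := by
      have h0 : 0 < √(π' i) := Real.sqrt_pos.2 (hπ0' i)
      have h := hr i
      have h' : 1 / √(π' i) ≤ r - √(n : ℝ) := by linarith
      rw [div_le_iff₀ h0] at h'
      calc (1 : ℝ) = 1 ^ 2 := by norm_num
        _ ≤ ((r - √(n : ℝ)) * √(π' i)) ^ 2 := by gcongr
        _ = _ := by rw [mul_pow, Real.sq_sqrt (hπ0' i).le]
    have e : π' i * ‖(π' i)⁻¹ • d i‖ ^ 2 = (π' i)⁻¹ * ‖d i‖ ^ 2 := by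
      rw [norm_smul, mul_pow, norm_inv, Real.norm_of_nonneg (hπ0' i).le]
      field_simp [(hπ0' i).ne']
    rw [e, one_mul]
    gcongr
    rwa [inv_le_iff_one_le_mul₀ (hπ0' i)]
  have h2 : wnorm π' (fun _ => ∑ j, d j) ≤ √(n : ℝ) * N := by
    refine wnorm_le hπ'.1 (by positivity) ?_
    rw [← Finset.sum_mul, hπ'.2, one_mul]
    have h := sum_norm_le_mul_wnorm hone zero_le_one (fun i => by norm_num) d
    rw [mul_one] at h
    have := (norm_sum_le Finset.univ d).trans h
    gcongr
  have h3 : wnorm π' (fun i => (π' i)⁻¹ • y' i - ∑ j, y' j) ≤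
      τ * wnorm π (fun i => (π i)⁻¹ • y i - s) + r * N := by
    have e : (fun i => (π' i)⁻¹ • y' i - ∑ j, y' j) = fun i =>
        ((π' i)⁻¹ • (∑ j, B i j • y j) - s) + ((π' i)⁻¹ • d i - ∑ j, d j) := by
      ext i
      rw [hsum, hy' i, add_sub_assoc, smul_add]
      simp only [hd]
      abel
    rw [e]
    have ha := wnorm_add_le π' (fun i => (π' i)⁻¹ • (∑ j, B i j • y j) - s)
      (fun i => (π' i)⁻¹ • d i - ∑ j, d j)
    have hb := wnorm_sub_le π' (fun i => (π' i)⁻¹ • d i) (fun _ => ∑ j, d j)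
    linarith
  -- the movement of the points
  set D := wnorm φ (fun i => x i - wmean φ x) with hD
  have h4 : N ≤ L * wnorm (fun _ => 1) (fun i => x' i - x i) := by
    refine wnorm_le_mul_wnorm hone hone hL.le fun i => ?_
    have := hg i (x' i) (x i)
    rw [one_mul, one_mul, ← mul_pow]
    gcongr
  have h5 : ∀ (ψ : Fin n → ℝ) (z : Fin n → E), (∀ i, 0 ≤ ψ i) → (∀ i, 1 ≤ R ^ 2 * ψ i) →
      wnorm (fun _ => 1) z ≤ R * wnorm ψ z := fun ψ z hψ hψR => by
    refine wnorm_le_mul_wnorm hone hψ hR fun i => ?_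
    rw [← mul_assoc]
    exact mul_le_mul_of_nonneg_right (hψR i) (sq_nonneg _)
  have h6 : wnorm (fun _ => 1) (fun i => x' i - x i) ≤
      R * (c * D) + R * D + α * wnorm (fun _ => 1) y := by
    have e : (fun i => x' i - x i) = fun i =>
        ((∑ j, A i j • x j - wmean φ x) - (x i - wmean φ x)) - α • y i := by
      ext i; rw [hx' i]; abel
    have ha := wnorm_sub_le (fun _ => 1)
      (fun i => (∑ j, A i j • x j - wmean φ x) - (x i - wmean φ x)) (fun i => α • y i)
    have hb := wnorm_sub_le (fun _ => 1)
      (fun i => ∑ j, A i j • x j - wmean φ x) (fun i => x i - wmean φ x)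
    rw [wnorm_smul, abs_of_pos hα] at ha
    have hc1 := (h5 φ' (fun i => ∑ j, A i j • x j - wmean φ x) hφ'.1 hφR').trans
      (mul_le_mul_of_nonneg_left hc hR)
    have hc2 := h5 φ (fun i => x i - wmean φ x) hφ.1 hφR
    rw [e]
    linarith
  have h7 := wnorm_le_add_norm_sum hone (fun _ => le_rfl) hπ hπ0 y s
  have h8 := norm_sum_directions_le hφ hR hφR hL hg hxs hy
  have hr1 : 0 ≤ r := (Real.sqrt_nonneg _).trans hr0
  refine h3.trans ?_
  calc _ ≤ τ * wnorm π (fun i => (π i)⁻¹ • y i - s) + r * (L * (R * (c * D) + R * D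
          + α * (wnorm π (fun i => (π i)⁻¹ • y i - s)
            + L * √(n : ℝ) * R * (D + ‖wmean φ x - xs‖)))) := by
        refine add_le_add_right (mul_le_mul_of_nonneg_left (h4.trans ?_) hr1) _
        refine mul_le_mul_of_nonneg_left (h6.trans ?_) hL.le
        exact add_le_add_right
          (mul_le_mul_of_nonneg_left (h7.trans (add_le_add_right h8 _)) hα.le) _
    _ = _ := by ring

end OneStep

/-! ### The iterates and their errors -/

section Iterates

variable {n p : ℕ} {A B : ℕ → Matrix (Fin n) (Fin n) ℝ}
  {f : Fin n → EuclideanSpace ℝ (Fin p) → ℝ} {α : ℝ} {x₀ : Fin n → EuclideanSpace ℝ (Fin p)}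

theorem iterates_fst_succ (k : ℕ) (i : Fin n) : (iterates A B f α x₀ (k + 1)).1 i =
    ∑ j, A k i j • (iterates A B f α x₀ k).1 j - α • (iterates A B f α x₀ k).2 i := rfl

theorem iterates_snd_succ (k : ℕ) (i : Fin n) : (iterates A B f α x₀ (k + 1)).2 i =
    ∑ j, B k i j • (iterates A B f α x₀ k).2 j + ∇ (f i) ((iterates A B f α x₀ (k + 1)).1 i)
      - ∇ (f i) ((iterates A B f α x₀ k).1 i) := rfl

/-- Gradient tracking: the directions sum to the sum of the local gradients. -/
theorem sum_iterates_snd (hB : ∀ k j, ∑ i, B k i j = 1) (k : ℕ) :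
    ∑ i, (iterates A B f α x₀ k).2 i = ∑ i, ∇ (f i) ((iterates A B f α x₀ k).1 i) := by
  induction k with
  | zero => rfl
  | succ k ih =>
    simp_rw [iterates_snd_succ, Finset.sum_sub_distrib, Finset.sum_add_distrib]
    rw [Finset.sum_comm]
    simp_rw [← Finset.sum_smul, hB, one_smul]
    rw [ih]
    abel

/-- One step of `B k`, written for the scaled directions `y i / π i`, is mixing by the
row-stochastic matrix with entries `B i j π j / π' i`. -/
theorem wnorm_tracking_contraction {E : Type*} [NormedAddCommGroup E] [InnerProductSpace ℝ E]
    {G : Digraph (Fin n)} (hG : StronglyConnected G)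
    {B : Matrix (Fin n) (Fin n) ℝ} {b : ℝ} (hb : 0 < b) (hB : B ∈ Matrix.colStochastic ℝ (Fin n))
    (hBG : Compatible G B) (hBb : ∀ i j, 0 < B i j → b ≤ B i j) {π : Fin n → ℝ}
    (hπ : π ∈ stdSimplex ℝ (Fin n)) (hπ0 : ∀ i, 0 < π i) (hπ' : ∀ i, 0 < (B.mulVec π) i)
    {t : ℝ} (ht : √(1 - minEntry π ^ 2 * b ^ 2 / (maxEntry π ^ 2 * maxEntry (B.mulVec π) *
      (diameter G : ℝ) * (maxEdgeUtility G : ℝ))) ≤ t) (ht1 : t ≤ 1) (y : Fin n → E) :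
    wnorm (B.mulVec π) (fun i => (B.mulVec π i)⁻¹ • (∑ j, B i j • y j) - ∑ j, y j) ≤
      t * wnorm π (fun i => (π i)⁻¹ • y i - ∑ j, y j) := by
  obtain ⟨i₀⟩ : Nonempty (Fin n) := by
    by_contra h
    rw [not_nonempty_iff] at h
    simpa using hπ.2
  have : NeZero n := ⟨by rintro rfl; exact i₀.elim0⟩
  set π' := B.mulVec π with hπ'def
  let W : Matrix (Fin n) (Fin n) ℝ := fun i j => B i j * π j / π' i
  have hB0 : ∀ i j, 0 ≤ B i j := fun i j => Matrix.nonneg_of_mem_colStochastic hB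
  have hW : ∀ i, W i ∈ stdSimplex ℝ (Fin n) := fun i =>
    ⟨fun j => div_nonneg (mul_nonneg (hB0 i j) (hπ0 j).le) (hπ' i).le, by
      change ∑ j, B i j * π j / π' i = 1
      rw [← Finset.sum_div]
      exact div_self (hπ' i).ne'⟩
  have hWπ : ∀ j, ∑ i, π' i * W i j = π j := fun j => by
    calc ∑ i, π' i * W i j = ∑ i, B i j * π j :=
          Finset.sum_congr rfl fun i _ => mul_div_cancel₀ _ (hπ' i).ne'
      _ = π j := by rw [← Finset.sum_mul, Matrix.sum_col_of_mem_colStochastic hB, one_mul]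
  have hmin := minEntry_pos hπ0
  have hmax' : 0 < maxEntry π' := (hπ' i₀).trans_le (le_maxEntry π' i₀)
  have hκ : ∀ i j, G.Adj j i →
      minEntry π ^ 2 * b ^ 2 / maxEntry π' ≤ π' i * (W i j * W i i) := by
    intro i j hji
    have e : π' i * (W i j * W i i) = (π j * π i) * (B i j * B i i) / π' i := by
      have := (hπ' i).ne'
      simp only [W]
      field_simp
    rw [e]
    have h1 := hBb i j ((hBG i j).1 (Or.inl hji))
    have h2 := hBb i i ((hBG i i).1 (Or.inr rfl))
    have h3 := le_maxEntry π' i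
    have h4 := minEntry_le π i
    have h5 := minEntry_le π j
    rw [sq, sq]
    gcongr
    · exact mul_nonneg (mul_nonneg (hπ0 j).le (hπ0 i).le) (mul_nonneg (hB0 _ _) (hB0 _ _))
    · exact hπ' i
    · exact mul_nonneg (hπ0 j).le (hπ0 i).le
    · exact (hπ0 j).le
    · exact hB0 i j
  have key := wnorm_mix_sub_wmean_le hG hW hπ (fun i => (hπ' i).le) hWπ hκ (by positivity)
    (le_maxEntry π) (c := t) (by
      refine le_trans (le_of_eq ?_) ht
      rw [div_div]
      congr 3
      ring) fun i => (π i)⁻¹ • y i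
  have e1 : wmean π (fun i => (π i)⁻¹ • y i) = ∑ j, y j :=
    Finset.sum_congr rfl fun i _ => smul_inv_smul₀ (hπ0 i).ne' _
  have e2 : ∀ i, ∑ j, W i j • (π j)⁻¹ • y j = (π' i)⁻¹ • ∑ j, B i j • y j := fun i => by
    rw [Finset.smul_sum]
    refine Finset.sum_congr rfl fun j _ => ?_
    rw [smul_smul, smul_smul]
    congr 1
    have := (hπ0 j).ne'
    simp only [W]
    field_simp
  simp only [e1, e2] at key
  have ht0 : 0 ≤ t := (Real.sqrt_nonneg _).trans ht
  refine key.trans (mul_le_mul_of_nonneg_right ?_ (wnorm_nonneg _ _))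
  nlinarith

/-- One step of `A k` contracts the consensus error by the factor `c ^ 2`. -/
theorem wnorm_consensus_contraction {E : Type*} [NormedAddCommGroup E] [InnerProductSpace ℝ E]
    {G : Digraph (Fin n)} (hG : StronglyConnected G)
    {A : Matrix (Fin n) (Fin n) ℝ} {a : ℝ} (ha : 0 < a) (hA : A ∈ Matrix.rowStochastic ℝ (Fin n))
    (hAG : Compatible G A) (hAa : ∀ i j, 0 < A i j → a ≤ A i j) {φ φ' : Fin n → ℝ}
    (hφ : φ ∈ stdSimplex ℝ (Fin n)) (hφ' : ∀ i, 0 < φ' i) (hφA : ∀ j, ∑ i, φ' i * A i j = φ j)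
    {c : ℝ} (hc : √(1 - minEntry φ' * a ^ 2 / (maxEntry φ ^ 2 * (diameter G : ℝ) *
      (maxEdgeUtility G : ℝ))) ≤ c) (x : Fin n → E) :
    wnorm φ' (fun i => ∑ j, A i j • x j - wmean φ x) ≤
      c ^ 2 * wnorm φ (fun i => x i - wmean φ x) := by
  have hmin : 0 ≤ minEntry φ' := Real.iInf_nonneg fun i => (hφ' i).le
  refine wnorm_mix_sub_wmean_le hG (fun i => ⟨fun j => hA.1 i j,
    Matrix.sum_row_of_mem_rowStochastic hA i⟩) hφ (fun i => (hφ' i).le) hφA ?_ (by positivity)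
    (le_maxEntry φ) hc x
  intro i j hji
  have h1 := hAa i j ((hAG i j).1 (Or.inl hji))
  have h2 := hAa i i ((hAG i i).1 (Or.inr rfl))
  have h3 := minEntry_le φ' i
  rw [sq]
  gcongr
  · exact (hφ' i).le
  · exact hA.1 i j

/-- The vector of the distance of the weighted mean of `x` to `xs`, the consensus error, and the
tracking error, with the weights `φ` and `π`. -/
noncomputable def errorVec {E : Type*} [NormedAddCommGroup E] [InnerProductSpace ℝ E]
    (φ π : Fin n → ℝ) (xs : E) (q : (Fin n → E) × (Fin n → E)) : Fin 3 → ℝ :=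
  ![‖wmean φ q.1 - xs‖, wnorm φ (fun i => q.1 i - wmean φ q.1),
    wnorm π (fun i => (π i)⁻¹ • q.2 i - ∑ j, q.2 j)]

theorem norm_sub_le_errorVec {E : Type*} [NormedAddCommGroup E] [InnerProductSpace ℝ E]
    {φ π : Fin n → ℝ} (hφ : ∀ i, 0 ≤ φ i) {R : ℝ} (hR : 0 ≤ R) (hφR : ∀ i, 1 ≤ R ^ 2 * φ i)
    (xs : E) (q : (Fin n → E) × (Fin n → E)) (i : Fin n) :
    ‖q.1 i - xs‖ ≤ errorVec φ π xs q 0 + R * errorVec φ π xs q 1 := by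
  change _ ≤ ‖wmean φ q.1 - xs‖ + R * wnorm φ (fun i => q.1 i - wmean φ q.1)
  have h : ‖q.1 i - wmean φ q.1‖ ≤ R * wnorm φ (fun i => q.1 i - wmean φ q.1) := by
    refine le_of_sq_le_sq ?_ (mul_nonneg hR (wnorm_nonneg _ _))
    rw [mul_pow, wnorm_sq hφ]
    calc ‖q.1 i - wmean φ q.1‖ ^ 2 ≤ R ^ 2 * (φ i * ‖q.1 i - wmean φ q.1‖ ^ 2) := by
          rw [← mul_assoc]; exact le_mul_of_one_le_left (sq_nonneg _) (hφR i)
      _ ≤ _ := by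
          gcongr
          exact Finset.single_le_sum (f := fun i => φ i * ‖q.1 i - wmean φ q.1‖ ^ 2)
            (fun j _ => mul_nonneg (hφ j) (sq_nonneg _)) (Finset.mem_univ i)
  calc ‖q.1 i - xs‖ = ‖(wmean φ q.1 - xs) + (q.1 i - wmean φ q.1)‖ := by
        congr 1; abel
    _ ≤ _ := (norm_add_le _ _).trans (add_le_add_right h _)

end Iterates

/-! ### The average objective -/

section Objective

variable {n p : ℕ} {f : Fin n → EuclideanSpace ℝ (Fin p) → ℝ}

theorem hasGradientAt_avgObj (hf : ∀ i, ContDiff ℝ 1 (f i)) (x : EuclideanSpace ℝ (Fin p)) :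
    HasGradientAt (avgObj f) ((1 / (n : ℝ)) • ∑ i, ∇ (f i) x) x := by
  have h : ∀ i, HasFDerivAt (f i) (InnerProductSpace.toDual ℝ _ (∇ (f i) x)) x := fun i =>
    (((hf i).differentiable one_ne_zero).differentiableAt.hasGradientAt).hasFDerivAt
  rw [hasGradientAt_iff_hasFDerivAt]
  refine ((HasFDerivAt.fun_sum fun i _ => h i).const_mul (1 / (n : ℝ))).congr_fderiv ?_
  simp

theorem norm_avg_gradient_sub_le [NeZero n] {L : ℝ}
    (hfL : ∀ i x u, ‖∇ (f i) x - ∇ (f i) u‖ ≤ L * ‖x - u‖) (x u : EuclideanSpace ℝ (Fin p)) :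
    ‖(1 / (n : ℝ)) • ∑ i, ∇ (f i) x - (1 / (n : ℝ)) • ∑ i, ∇ (f i) u‖ ≤ L * ‖x - u‖ := by
  have hn : 0 < (n : ℝ) := Nat.cast_pos.2 (NeZero.pos n)
  rw [← smul_sub, ← Finset.sum_sub_distrib, norm_smul, Real.norm_of_nonneg (by positivity),
    one_div, inv_mul_le_iff₀ hn]
  refine (norm_sum_le _ _).trans ((Finset.sum_le_sum fun i _ => hfL i x u).trans (le_of_eq ?_))
  simp

end Objective

/-- Replacing `c` by `c ^ 2` strictly increases the bound `n σ μ (1 - τ) (1 - c) / η`. -/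
theorem mul_eta_sq_lt {n : ℕ} [NeZero n] {L μ c τ r ϕ σ α : ℝ} (hL : 0 < L)
    (hc : c ∈ Set.Ioo (0 : ℝ) 1) (hτ : τ ∈ Set.Ioo (0 : ℝ) 1) (hr : 0 < r) (hϕ : 0 < ϕ)
    (hα : 0 < α) (hσ : 0 < σ) (hμ : 0 < μ)
    (hη : α * eta n L μ c τ r ϕ σ ≤ n * σ * μ * (1 - τ) * (1 - c)) :
    α * eta n L μ (c ^ 2) τ r ϕ σ < n * σ * μ * (1 - τ) * (1 - c ^ 2) := by
  obtain ⟨hc0, hc1⟩ := hc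
  obtain ⟨hτ0, hτ1⟩ := hτ
  have hn : 0 < (n : ℝ) := Nat.cast_pos.2 (NeZero.pos n)
  have hsn : 0 < √(n : ℝ) := Real.sqrt_pos.2 hn
  have hlt : eta n L μ (c ^ 2) τ r ϕ σ < eta n L μ c τ r ϕ σ * (1 + c) := by
    rw [eta, eta, mul_assoc _ _ (1 + c)]
    refine mul_lt_mul_of_pos_left ?_ (by positivity)
    have h1 : 0 < (1 - τ) * √(n : ℝ) * ϕ := by
      have : 0 < 1 - τ := by linarith
      positivity
    have h2 : 0 < r * ϕ * c := by positivity
    have h3 : 0 < (1 - τ) * √(n : ℝ) * ϕ * c := by positivity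
    nlinarith
  calc _ < α * (eta n L μ c τ r ϕ σ * (1 + c)) := mul_lt_mul_of_pos_left hlt hα
    _ = α * eta n L μ c τ r ϕ σ * (1 + c) := by ring
    _ ≤ n * σ * μ * (1 - τ) * (1 - c) * (1 + c) := by gcongr
    _ = _ := by ring

end PushPull

theorem mainTheorem1 {n p : ℕ} (hn : 2 ≤ n)
    -- strongly connected directed graphs
    (G : ℕ → Digraph (Fin n)) (hG : ∀ k, PushPull.StronglyConnected (G k))
    -- row-stochastic, graph compatible `A_k` with positive entries bounded below by `a`
    (A : ℕ → Matrix (Fin n) (Fin n) ℝ) (a : ℝ) (ha : 0 < a)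
    (hA : ∀ k, A k ∈ Matrix.rowStochastic ℝ (Fin n))
    (hAG : ∀ k, PushPull.Compatible (G k) (A k))
    (hAa : ∀ k i j, 0 < A k i j → a ≤ A k i j)
    -- column-stochastic, graph compatible `B_k` with positive entries bounded below by `b`
    (B : ℕ → Matrix (Fin n) (Fin n) ℝ) (b : ℝ) (hb : 0 < b)
    (hB : ∀ k, B k ∈ Matrix.colStochastic ℝ (Fin n))
    (hBG : ∀ k, PushPull.Compatible (G k) (B k))
    (hBb : ∀ k i j, 0 < B k i j → b ≤ B k i j)
    -- continuously differentiable `f_i` with `L`-Lipschitz gradients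
    (f : Fin n → EuclideanSpace ℝ (Fin p) → ℝ) (L : ℝ) (hL : 0 < L)
    (hf : ∀ i, ContDiff ℝ 1 (f i))
    (hfL : ∀ i x u, ‖∇ (f i) x - ∇ (f i) u‖ ≤ L * ‖x - u‖)
    -- `μ`-strong convexity of the average objective
    (μ : ℝ) (hμ : 0 < μ)
    (hfμ : ∀ x u, μ * ‖x - u‖ ^ 2 ≤
      inner ℝ (∇ (PushPull.avgObj f) x - ∇ (PushPull.avgObj f) u) (x - u))
    -- the stochastic vectors associated with the matrices `A_k`
    (φ : ℕ → Fin n → ℝ) (hφ : PushPull.IsAbsProb A φ)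
    -- uniform bounds `c`, `τ`, `r`, `ϕ`, `σ`
    (c τ r ϕ σ : ℝ) (hc : c ∈ Set.Ioo (0 : ℝ) 1) (hτ : τ ∈ Set.Ioo (0 : ℝ) 1) (hσ : 0 < σ)
    (hck : ∀ k, PushPull.cSeq G a φ k ≤ c)
    (hτk : ∀ k, PushPull.tauSeq G b (PushPull.piVec B) k ≤ τ)
    (hrk : ∀ k, PushPull.rSeq (PushPull.piVec B) k ≤ r)
    (hϕk : ∀ k, PushPull.phiSeq φ k ≤ ϕ)
    (hσk : ∀ k, σ ≤ PushPull.minEntry (PushPull.piVec B k))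
    -- the stepsize
    (α : ℝ) (hα : 0 < α)
    (hα_le : α ≤ min (min ((1 - c) / (L * √(n : ℝ) * ϕ)) ((1 - τ) / (L * r)))
      (min (n * σ * μ * (1 - τ) * (1 - c) / PushPull.eta n L μ c τ r ϕ σ)
        (2 / (n * (L + μ)))))
    -- the starting points
    (x₀ : Fin n → EuclideanSpace ℝ (Fin p)) :
    ∃ xstar : EuclideanSpace ℝ (Fin p),
      -- `xstar` is the unique minimizer of the average objective
      (∀ z, PushPull.avgObj f xstar ≤ PushPull.avgObj f z) ∧
      (∀ z, (∀ w, PushPull.avgObj f z ≤ PushPull.avgObj f w) → z = xstar) ∧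
      -- convergence
      (∀ i, Tendsto (fun k => ‖(PushPull.iterates A B f α x₀ k).1 i - xstar‖) atTop (𝓝 0)) ∧
      -- at a linear rate
      (∃ C ρ : ℝ, 0 ≤ ρ ∧ ρ < 1 ∧
        ∀ i k, ‖(PushPull.iterates A B f α x₀ k).1 i - xstar‖ ≤ C * ρ ^ k) ∧
      -- given by the spectral radius of `M(α)` unless `α` equals the third bound
      (α < n * σ * μ * (1 - τ) * (1 - c) / PushPull.eta n L μ c τ r ϕ σ →
        PushPull.specRad (PushPull.compMatrix n L μ c τ r ϕ σ α) < 1 ∧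
        ∃ C : ℝ, ∀ i k, ‖(PushPull.iterates A B f α x₀ k).1 i - xstar‖ ≤
          C * PushPull.specRad (PushPull.compMatrix n L μ c τ r ϕ σ α) ^ k) := by
  have : NeZero n := ⟨by omega⟩
  have hn0 : 0 < (n : ℝ) := Nat.cast_pos.2 (by omega)
  have hsn : 0 < √(n : ℝ) := Real.sqrt_pos.2 hn0
  obtain ⟨hc0, hc1⟩ := hc
  obtain ⟨hτ0, hτ1⟩ := hτ
  -- the stochastic vectors
  set π := PushPull.piVec B with hπdef
  have hπ := PushPull.piVec_mem_stdSimplex (B := B) (by omega) hB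
  have hπσ : ∀ k i, σ ≤ π k i := fun k i => (hσk k).trans (PushPull.minEntry_le _ i)
  have hπ0 : ∀ k i, 0 < π k i := fun k i => hσ.trans_le (hπσ k i)
  have hφ0 := hφ.pos hG hA hAG
  have hφA : ∀ k j, ∑ i, φ (k + 1) i * A k i j = φ k j := fun k j => congrFun (hφ.2 k) j
  have hφmin : ∀ k, 0 < PushPull.minEntry (φ k) := fun k => PushPull.minEntry_pos (hφ0 k)
  have hϕ0 : 0 < ϕ :=
    (Real.sqrt_pos.2 (one_div_pos.2 (hφmin 0))).trans_le (hϕk 0)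
  have hφR : ∀ k i, 1 ≤ ϕ ^ 2 * φ k i := fun k i => by
    have h := (Real.sqrt_le_iff.1 (hϕk k)).2
    rw [div_le_iff₀ (hφmin k)] at h
    exact h.trans (mul_le_mul_of_nonneg_left (PushPull.minEntry_le _ i) (sq_nonneg ϕ))
  have hr : ∀ k i, √(n : ℝ) + 1 / √(π (k + 1) i) ≤ r := fun k i => by
    refine le_trans ?_ (hrk k)
    have h1 := PushPull.minEntry_le (π (k + 1)) i
    have h2 : 0 < PushPull.minEntry (π (k + 1)) := hσ.trans_le (hσk (k + 1))
    rw [PushPull.rSeq]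
    gcongr
  have hr0 : 0 < r := by
    have h := hr 0 0
    have h1 : 0 ≤ 1 / √(π (0 + 1) 0) := by positivity
    linarith
  -- the stepsize
  have hτ1' : 0 < 1 - τ := sub_pos.2 hτ1
  have hc1' : 0 < 1 - c := sub_pos.2 hc1
  have hη0 : 0 < PushPull.eta n L μ c τ r ϕ σ := by
    rw [PushPull.eta]; positivity
  have hα3 : α * PushPull.eta n L μ c τ r ϕ σ ≤ n * σ * μ * (1 - τ) * (1 - c) :=
    (le_div_iff₀ hη0).1 (hα_le.trans ((min_le_right _ _).trans (min_le_left _ _)))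
  have hα4 : α ≤ 2 / (n * (L + μ)) :=
    hα_le.trans ((min_le_right _ _).trans (min_le_right _ _))
  have hnσ : n * σ ≤ 1 := by
    have h := Finset.sum_le_sum fun i (_ : i ∈ (Finset.univ : Finset (Fin n))) => hπσ 0 i
    rw [(hπ 0).2] at h
    simpa using h
  have hαμ : α * n * σ * μ < 1 := by
    have h1 : α * (n * (L + μ)) ≤ 2 := (le_div_iff₀ (by positivity)).1 hα4
    have h2 : (2 : ℝ) ≤ n := by exact_mod_cast hn
    have h3 : α * n * σ * μ ≤ α * μ := by
      calc α * n * σ * μ = (n * σ) * (α * μ) := by ring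
        _ ≤ 1 * (α * μ) := by gcongr
        _ = α * μ := one_mul _
    have h4 : α * (L + μ) * 2 ≤ α * (L + μ) * n := by gcongr
    nlinarith [mul_pos hα hL]
  -- the average objective and its minimizer
  have hgrad := PushPull.hasGradientAt_avgObj hf
  have hLip := PushPull.norm_avg_gradient_sub_le hfL
  have hmono : ∀ x u, μ * ‖x - u‖ ^ 2 ≤
      inner ℝ ((1 / (n : ℝ)) • ∑ i, ∇ (f i) x - (1 / (n : ℝ)) • ∑ i, ∇ (f i) u) (x - u) := by
    intro x u
    have h := hfμ x u
    rwa [(hgrad x).gradient, (hgrad u).gradient] at h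
  obtain ⟨xs, hxs⟩ := PushPull.exists_gradient_eq_zero hL hμ hgrad hLip hmono
  obtain ⟨hmin, huniq⟩ := PushPull.unique_minimizer_of_gradient_eq_zero hμ hgrad hmono hxs
  have hxs' : ∑ i, ∇ (f i) xs = 0 :=
    (smul_eq_zero.1 hxs).resolve_left (one_div_ne_zero hn0.ne')
  have hstep : ∀ h, 0 ≤ h → h ≤ 2 / (L + μ) → ∀ x,
      ‖x - h • ((1 / (n : ℝ)) • ∑ i, ∇ (f i) x) - xs‖ ≤ (1 - h * μ) * ‖x - xs‖ := by
    intro h hh hh2 x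
    have := PushPull.norm_gradient_step_sub_le hL hμ hgrad hLip hmono hh hh2 x xs
    rwa [hxs, smul_zero, sub_zero] at this
  -- the errors decay at the rate of `M(α)`, for every admissible contraction factor `c'`
  have core : ∀ c', 0 < c' →
      (∀ k (x : Fin n → EuclideanSpace ℝ (Fin p)),
        PushPull.wnorm (φ (k + 1)) (fun i => ∑ j, A k i j • x j - PushPull.wmean (φ k) x) ≤
          c' * PushPull.wnorm (φ k) (fun i => x i - PushPull.wmean (φ k) x)) →
      ∃ C : ℝ, ∀ i k, ‖(PushPull.iterates A B f α x₀ k).1 i - xs‖ ≤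
        C * PushPull.specRad (PushPull.compMatrix n L μ c' τ r ϕ σ α) ^ k := by
    intro c' hc' hcontr
    obtain ⟨C, hC⟩ := PushPull.exists_forall_le_mul_specRad_pow
      (M := PushPull.compMatrix n L μ c' τ r ϕ σ α)
      (PushPull.compMatrix_pos hL hc' hτ0 hr0 hϕ0 hα hαμ)
      (v := fun k => PushPull.errorVec (φ k) (π k) xs (PushPull.iterates A B f α x₀ k)) (by
        intro k
        have hy := PushPull.sum_iterates_snd (f := f) (A := A) (α := α) (x₀ := x₀)
          (fun k => Matrix.sum_col_of_mem_colStochastic (hB k)) k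
        have hx' := PushPull.iterates_fst_succ (f := f) (A := A) (B := B) (α := α) (x₀ := x₀) k
        have hy' := PushPull.iterates_snd_succ (f := f) (A := A) (B := B) (α := α) (x₀ := x₀) k
        have r0 := PushPull.norm_wmean_step_le (hφ.1 k) (hφ.1 (k + 1)) (hφA k) hϕ0.le (hφR k)
          (hπ k) hσ (hπσ k) hL hμ hα hfL hstep hα4 hy
        have r1 := PushPull.wnorm_consensus_step_le (hφ.1 k) (hφ.1 (k + 1)) hϕ0.le (hφR k)
          (hπ k) (hπ0 k) hL hα hfL hxs' hy (hcontr k _) hx'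
        have r2 := PushPull.wnorm_tracking_step_le (hφ.1 k) (hφ.1 (k + 1)) hϕ0.le (hφR k)
          (hφR (k + 1)) (hπ k) (hπ0 k) (hπ (k + 1)) (hπ0 (k + 1))
          (Matrix.sum_col_of_mem_colStochastic (hB k)) (hr k) hL hα hfL hxs' hy (hcontr k _)
          (PushPull.wnorm_tracking_contraction (hG k) hb (hB k) (hBG k) (hBb k) (hπ k) (hπ0 k)
            (hπ0 (k + 1)) (hτk k) hτ1.le _) hx' hy'
        intro i
        simp only [PushPull.compMatrix, Matrix.mulVec, dotProduct, Fin.sum_univ_three]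
        fin_cases i
        · exact r0
        · exact r1
        · exact r2)
    refine ⟨C + ϕ * C, fun i k => ?_⟩
    calc _ ≤ _ := PushPull.norm_sub_le_errorVec (π := π k) (fun i => (hφ0 k i).le) hϕ0.le (hφR k)
          xs (PushPull.iterates A B f α x₀ k) i
      _ ≤ _ := add_le_add (hC k 0) (mul_le_mul_of_nonneg_left (hC k 1) hϕ0.le)
      _ = _ := by ring
  have hcontr : ∀ k (x : Fin n → EuclideanSpace ℝ (Fin p)),
      PushPull.wnorm (φ (k + 1)) (fun i => ∑ j, A k i j • x j - PushPull.wmean (φ k) x) ≤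
        c ^ 2 * PushPull.wnorm (φ k) (fun i => x i - PushPull.wmean (φ k) x) := fun k x =>
    PushPull.wnorm_consensus_contraction (hG k) ha (hA k) (hAG k) (hAa k) (hφ.1 k)
      (hφ0 (k + 1)) (hφA k) (hck k) x
  have hcc : c ^ 2 ≤ c := by nlinarith
  -- the factor `c ^ 2` leaves room in the stepsize bound, so the extreme stepsize is covered
  obtain ⟨C, hC⟩ := core (c ^ 2) (by positivity) hcontr
  set ρ := PushPull.specRad (PushPull.compMatrix n L μ (c ^ 2) τ r ϕ σ α) with hρ
  have hρ0 : 0 ≤ ρ := ENNReal.toReal_nonneg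
  have hρ1 : ρ < 1 := PushPull.specRad_compMatrix_lt_one hL
    ⟨by positivity, by linarith⟩ ⟨hτ0, hτ1⟩ hr0 hϕ0 hα hσ hμ hαμ
    (PushPull.mul_eta_sq_lt hL ⟨hc0, hc1⟩ ⟨hτ0, hτ1⟩ hr0 hϕ0 hα hσ hμ hα3)
  refine ⟨xs, hmin, huniq, fun i => ?_, ⟨C, ρ, hρ0, hρ1, hC⟩, fun hlt => ⟨?_, ?_⟩⟩
  · have h := (tendsto_pow_atTop_nhds_zero_of_lt_one hρ0 hρ1).const_mul C
    rw [mul_zero] at h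
    exact squeeze_zero (fun k => norm_nonneg _) (hC i) h
  · exact PushPull.specRad_compMatrix_lt_one hL ⟨hc0, hc1⟩ ⟨hτ0, hτ1⟩ hr0 hϕ0 hα hσ hμ hαμ
      ((lt_div_iff₀ hη0).1 hlt)
  · exact core c hc0 fun k x => (hcontr k x).trans
      (mul_le_mul_of_nonneg_right hcc (PushPull.wnorm_nonneg _ _))
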